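/- **Definitions.** A word $w=w_1\cdots w_n$ over $\mathbb N$ is a *Smirnov word* if $w_i\ne w_{i+1}$ for $1\le i<n$. Let $\mathcal W_n$ be the set of Smirnov words of length $n$, let $\mathrm{asc}\,w=|\{i: w_i<w_{i+1}\}|$, $\mathrm{des}\,w=|\{i: w_i>w_{i+1}\}|$ and $x_w=x_{w_1}\cdots x_{w_n}$. A nonempty finite rooted binary tree with vertices labeled by $\mathbb N$ is *Smirnov* if, whenever the left (resp. right) child of a vertex has the same label $i$ as that vertex, the vertex also has a right (resp. left) child, with label $<i$ (resp. $>i$). Let $\mathcal T$ be the set of Smirnov trees. The edge between a parent labeled $a$ and its right child labeled $b$ has weight $\bar\rho$ if $a\le b$ and $\rho$ if $a>b$; the edge between a left child labeled $a$ and its parent labeled $b$ has weight $\bar\lambda$ if $a\le b$ and $\lambda$ if $a>b$; a node labeled $a$ has weight $x_a$. The weight $w(T)$ is the product of the weights of all edges and nodes of $T$. The *principal path* $P(T)$ of $T\in\mathcal T$ starts at the root; at a vertex with no right child it stops; at a vertex with a right child and a left child of the same label as the vertex it goes to the left child; otherwise it goes to the right child. Its last vertex $\alpha(T)$ has label denoted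 $a(T)$; $M(T)$ and $m(T)$ are the maximal and minimal labels on $P(T)$. *The map $\Phi$.* Let $T\in\mathcal T$, $S\in\mathcal T\cup\{D,U\}$, $b\in\mathbb N$ with $a:=a(T)\neq b$; write $\alpha=\alpha(T)$, $M=M(T)$, $m=m(T)$, and, if $S\in\mathcal T$, let $c$ be the label of the root of $S$. If $a<b\le M$ (resp. $a>b\ge m$), let $\delta$ be the last vertex of $P(T)$ with label $\ge b$ (resp. $\le b$), and $d$ its label. The tree $\Phi(T,S,b)$ is obtained from $T$ as follows, where $\beta$ is a new node with label $b$. 1. If $S=D$, or $S\in\mathcal T$ and either $a,c<b$ or $a,c>b$: make $\beta$ the right child of $\alpha$; $\beta$ has no children if $S=D$, and has $S$ as its left subtree and no right child if $S\in\mathcal T$. In all other cases (that is, $S=U$, or $S\in\mathcal T$ with $a<b\le c$ or $a>b\ge c$), if $S\in\mathcal T$ then make $S$ the right subtree of $\alpha$, and moreover: 2. If $M<b$ or $m>b$: make $\beta$ a new root, with the tree as its left subtree and no right child. 3. If $\delta$ exists and $d\ne b$: replace the right subtree of $\delta$ by $\beta$; $\beta$ has the previous right subtree of $\delta$ as its left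 subtree, and has no right child. 4. If $a<b$, $\delta$ exists and $d=b$: replace the left subtree of $\delta$ by $\beta$; $\beta$ has the previous left subtree of $\delta$ as its left subtree, and has no right child. 5. If $a>b$, $\delta$ exists and $d=b$: replace the left subtree of $\delta$ by its right subtree and its right subtree by $\beta$; $\beta$ has the previous left subtree of $\delta$ as its left subtree, and has no right child. *The map $\Psi$.* For $n\ge1$, $w\in\mathcal W_n$ and $\mathcal S=(S_1,\dots,S_{n-1})\in(\mathcal T\cup\{D,U\})^{n-1}$, let $\Psi(w,\mathcal S)$ be the one-node tree labeled $w_1$ if $n=1$, and $$\Psi(w,\mathcal S)=\Phi\big(\Psi(w_1\cdots w_{n-1},(S_1,\dots,S_{n-2})),\,S_{n-1},\,w_n\big)\qquad\text{if } n\ge2.$$ The weight of $(w,\mathcal S)$ is $x_w\prod_{i=1}^{n-1}\omega_i$, where, if $w_i<w_{i+1}$, $\omega_i$ is $\bar\rho$, $\bar\lambda$ or $\bar\lambda\bar\rho\,w(S_i)$ according as $S_i=D$, $S_i=U$ or $S_i\in\mathcal T$; and, if $w_i>w_{i+1}$, $\omega_i$ is $\rho$, $\lambda$ or $\lambda\rho\,w(S_i)$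 respectively. **Theorem.** (a) (Functional equation.) The generating function $G(x)=\sum_{T\in\mathcal T}w(T)$ is a well-defined formal power series in $x_0,x_1,x_2,\dots$ over $\mathbb Z[\rho,\bar\rho,\lambda,\bar\lambda]$, and $$G(x)=\sum_{n\ge1}\ \sum_{w\in\mathcal W_n}s^{\mathrm{asc}\,w}\,t^{\mathrm{des}\,w}\,x_w,\qquad s=\bar\rho\bar\lambda\,G(x)+\bar\rho+\bar\lambda,\quad t=\rho\lambda\,G(x)+\rho+\lambda,$$ where the family on the right is summable as a family of formal power series. (b) (Bijection.) $\Psi$ is well defined, with $a(\Psi(w,\mathcal S))=w_n$ for $w\in\mathcal W_n$; it preserves weights, i.e. $w(\Psi(w,\mathcal S))$ is the weight of $(w,\mathcal S)$; and it is a bijection $$\Psi\colon\bigcup_{n\ge1}\mathcal W_n\times(\mathcal T\cup\{D,U\})^{n-1}\longrightarrow\mathcal T.$$ -/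

import Mathlib

open scoped MvPowerSeries.WithPiTopology

namespace Smirnov

/-! ## Labeled binary trees, Smirnov trees

Labeled rooted binary trees are modelled by `BinaryTree ℕ`, where `nil` stands for a missing
subtree; a tree in the sense of the theory is a value different from `nil`. -/

/-- The label of the root, or `none` for the empty tree. -/
def rootLabel : BinaryTree ℕ → Option ℕ
  | .nil => none
  | .node a _ _ => some a

/-- The Smirnov condition at a vertex with label `a`, left subtree `l`, right subtree `r`:
if the left (resp. right) child has label `a`, then there is a right (resp. left) child, and its
label is `< a` (resp. `> a`). -/
def LocalCondition (a : ℕ) (l r : BinaryTree ℕ) : Prop :=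
  (rootLabel l = some a → ∃ c, rootLabel r = some c ∧ c < a) ∧
  (rootLabel r = some a → ∃ c, rootLabel l = some c ∧ a < c)

/-- The Smirnov condition holds at every vertex. -/
def SatisfiesLocalConditions : BinaryTree ℕ → Prop
  | .nil => True
  | .node a l r => LocalCondition a l r ∧ SatisfiesLocalConditions l ∧ SatisfiesLocalConditions r

/-- A Smirnov tree: nonempty, with the Smirnov condition at every vertex. -/
def IsSmirnov (T : BinaryTree ℕ) : Prop :=
  T ≠ .nil ∧ SatisfiesLocalConditions T

/-- The set of Smirnov trees. -/
def SmirnovTree : Type := {T : BinaryTree ℕ // IsSmirnov T}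

/-- The list of labels on the principal path, from the root down: if there is no right child, stop;
if there is a left child with the same label, move down left; otherwise move down right. -/
def principalPath : BinaryTree ℕ → List ℕ
  | .nil => []
  | .node a l r =>
    if r = .nil then [a]
    else if rootLabel l = some a then a :: principalPath l
    else a :: principalPath r

/-- The label of the principal node, i.e. of the last vertex of the principal path. -/
def principalLabel (T : BinaryTree ℕ) : ℕ :=
  (principalPath T).getLastD 0

/-! ## Weights -/

/-- The four edge variables `ρ`, `ρ̄`, `λ`, `λ̄`. -/
inductive EdgeVar : Type
  | rho
  | rhoBar
  | lam
  | lamBar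
  deriving DecidableEq

/-- The coefficient ring `ℤ[ρ, ρ̄, λ, λ̄]`. -/
abbrev CoeffRing : Type := MvPolynomial EdgeVar ℤ

/-- Formal power series in the variables `x_0, x_1, x_2, …` over `ℤ[ρ, ρ̄, λ, λ̄]`. -/
abbrev Series : Type := MvPowerSeries ℕ CoeffRing

/-- Coefficients are discrete, so that infinite sums in `Series` (which carries the topology of
coefficientwise convergence) are sums of formal power series in the usual sense. -/
instance : TopologicalSpace CoeffRing := ⊥

instance : DiscreteTopology CoeffRing := ⟨rfl⟩

/-- An edge variable, as a power series. -/
noncomputable def edge (e : EdgeVar) : Series := MvPowerSeries.C (MvPolynomial.X e)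

/-- The node variable `x_a`. -/
noncomputable def x (a : ℕ) : Series := MvPowerSeries.X a

/-- The weight of the edge from a vertex labeled `a` to its left child (`1` if there is none):
`λ̄` if the child's label is at most `a`, and `λ` otherwise. -/
noncomputable def leftEdgeWeight (a : ℕ) (l : BinaryTree ℕ) : Series :=
  match rootLabel l with
  | none => 1
  | some c => if c ≤ a then edge .lamBar else edge .lam

/-- The weight of the edge from a vertex labeled `a` to its right child (`1` if there is none):
`ρ̄` if `a` is at most the child's label, and `ρ` otherwise. -/
noncomputable def rightEdgeWeight (a : ℕ) (r : BinaryTree ℕ) : Series :=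
  match rootLabel r with
  | none => 1
  | some c => if a ≤ c then edge .rhoBar else edge .rho

/-- The weight of a tree: the product of the weights of its edges and nodes. -/
noncomputable def weight : BinaryTree ℕ → Series
  | .nil => 1
  | .node a l r =>
    x a * leftEdgeWeight a l * rightEdgeWeight a r * weight l * weight r

/-- The generating function `G(x)` of Smirnov trees. -/
noncomputable def G : Series := ∑' T : SmirnovTree, weight T.1

/-! ## The map `Φ` -/

/-- The set `𝒯 ∪ {D, U}`. -/
inductive Step : Type
  | D
  | U
  | tree (S : SmirnovTree)

/-- `attach T X` makes `X` the right subtree of the principal node of `T` (which has no right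
child); `attach T .nil` is `T`. -/
def attach : BinaryTree ℕ → BinaryTree ℕ → BinaryTree ℕ
  | .nil, _ => .nil
  | .node a l r, X =>
    if r = .nil then .node a l X
    else if rootLabel l = some a then .node a (attach l X) r
    else .node a l (attach r X)

/-- Let `δ` be the last vertex on the principal path of the tree whose label satisfies `p`. The
subtree of the tree rooted at `δ`, with root label `d`, left subtree `l` and right subtree `r`, is
replaced by `op d l r`. (If there is no such vertex, the tree is unchanged.) -/
def replaceAtLast (p : ℕ → Prop) [DecidablePred p]
    (op : ℕ → BinaryTree ℕ → BinaryTree ℕ → BinaryTree ℕ) : BinaryTree ℕ → BinaryTree ℕ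
  | .nil => .nil
  | .node d l r =>
    if ∃ y ∈ (principalPath (.node d l r)).tail, p y then
      if rootLabel l = some d then .node d (replaceAtLast p op l) r
      else .node d l (replaceAtLast p op r)
    else if p d then op d l r
    else .node d l r

/-- Rules 2, 3, 4, 5 in the definition of `Φ(T, S, b)`. Here `X` is the subtree that is to become
the right subtree of the principal node `α` of `T`: the tree `S`, or `nil` if `S = U`. When `δ` is
defined and is not the last vertex of the principal path, whose next step is to the right,
`attach r X` is its right subtree `r` after `X` has become the right subtree of `α`. -/
def phiUp (T X : BinaryTree ℕ) (b : ℕ) : BinaryTree ℕ :=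
  if principalLabel T < b then
    if ∀ y ∈ principalPath T, y < b then
      -- rules 2a, 2c: new root
      .node b (attach T X) .nil
    else
      replaceAtLast (fun y => b ≤ y)
        (fun d l r =>
          if d = b then
            -- rules 4a, 4b
            .node d (.node b l .nil) (attach r X)
          else
            -- rules 3a, 3c
            .node d l (.node b (attach r X) .nil)) T
  else
    if ∀ y ∈ principalPath T, b < y then
      -- rules 2b, 2d: new root
      .node b (attach T X) .nil
    else
      replaceAtLast (fun y => y ≤ b)
        (fun d l r =>
          if d = b then
            -- rules 5a, 5b
            .node d (attach r X) (.node b l .nil)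
          else
            -- rules 3b, 3d
            .node d l (.node b (attach r X) .nil)) T

/-- The map `Φ(T, S, b)`, meaningful for a Smirnov tree `T` and `b ≠ principalLabel T`. -/
def phi (T : BinaryTree ℕ) (S : Step) (b : ℕ) : BinaryTree ℕ :=
  match S with
  | .D => attach T (.node b .nil .nil)
  | .U => phiUp T .nil b
  | .tree S =>
    let a := principalLabel T
    let c := (rootLabel S.1).getD 0
    if (a < b ∧ c < b) ∨ (b < a ∧ b < c) then attach T (.node b S.1 .nil)
    else phiUp T S.1 b

/-! ## Smirnov words and the map `Ψ` -/

/-- The set `𝒲_n` of Smirnov words of length `n`. -/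
def SmirnovWord (n : ℕ) : Type :=
  {w : Fin n → ℕ // ∀ i j : Fin n, (j : ℕ) = i + 1 → w i ≠ w j}

/-- The number of ascents of a word of length `n + 1`. -/
def asc {n : ℕ} (w : Fin (n + 1) → ℕ) : ℕ :=
  (Finset.univ.filter fun i : Fin n => w i.castSucc < w i.succ).card

/-- The number of descents of a word of length `n + 1`. -/
def des {n : ℕ} (w : Fin (n + 1) → ℕ) : ℕ :=
  (Finset.univ.filter fun i : Fin n => w i.succ < w i.castSucc).card

/-- The monomial `x_w`. -/
noncomputable def xWord {n : ℕ} (w : Fin n → ℕ) : Series := ∏ i, x (w i)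

/-- The map `Ψ`, defined by iterating `Φ`. -/
def psi : (n : ℕ) → (Fin (n + 1) → ℕ) → (Fin n → Step) → BinaryTree ℕ
  | 0, w, _ => .node (w 0) .nil .nil
  | n + 1, w, S =>
    phi (psi n (Fin.init w) (Fin.init S)) (S (Fin.last n)) (w (Fin.last (n + 1)))

/-- The factor, besides `w(T)` and `x_b`, in the weight of a triple `(T, S, b)` with
principal label `a` of `T`. -/
noncomputable def stepWeight (a b : ℕ) : Step → Series
  | .D => if a < b then edge .rhoBar else edge .rho
  | .U => if a < b then edge .lamBar else edge .lam
  | .tree S =>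
    if a < b then edge .lamBar * edge .rhoBar * weight S.1
    else edge .lam * edge .rho * weight S.1

/-- The weight of a pair `(w, (S_1, …, S_n))`, with `w` of length `n + 1`. -/
noncomputable def pairWeight {n : ℕ} (w : Fin (n + 1) → ℕ) (S : Fin n → Step) : Series :=
  xWord w * ∏ i : Fin n, stepWeight (w i.castSucc) (w i.succ) (S i)

/-- The series `s = ρ̄ λ̄ G + ρ̄ + λ̄`. -/
noncomputable def s : Series :=
  edge .rhoBar * edge .lamBar * G + edge .rhoBar + edge .lamBar

/-- The series `t = ρ λ G + ρ + λ`. -/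
noncomputable def t : Series :=
  edge .rho * edge .lam * G + edge .rho + edge .lam

end Smirnov

namespace Smirnov

/-! ## Induction along the principal path -/

/-! Everything rests on one property of Φ: it is a bijection from the triples (T, S, b) with a(T) ≠
b onto the Smirnov trees with more than one node. The new tree has principal label b, more nodes
than T, and weight equal to that of T times x_b times the factor of S. Iterating Φ then encodes a
tree by a word and a list of steps: the last letter is the principal label, and undoing Φ lowers the
number of nodes, so Ψ is bijective by induction.

The definition of Φ refers to the last vertex δ on the path satisfying an inequality, which is
awkward to invert. The proof replaces it by its graph `Inserts`, defined by recursion from the root: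
either β is placed at the current vertex, or the recursion enters the next subtree of the path
without changing the root label of that subtree. Hence the Smirnov condition and the edge weight at
the parent survive, and every property of Φ needs checking only where β is placed. `Inserts.phi_eq`
and `IsSmirnov.inserts_phi` identify the relation with Φ.

In rules 2–5 the piece below β or δ is a lower part of the path, with all labels strictly on one
side of b, to which S has been attached with its root not on that side. Such a piece can be cut
apart in exactly one way, at the first path label that leaves the side (`IsSmirnov.exists_attach`,
`IsSmirnov.attach_inj`). This gives surjectivity (`IsSmirnov.exists_inserts`) and injectivity
(`Inserts.inj`).

For the functional equation, fix a word. Its steps vary independently, and the factors at an ascent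
sum to s, at a descent to t. Summing over words and transporting along Ψ yields G. Summability holds
because only finitely many trees have a given multiset of labels. -/

theorem rootLabel_eq_none {T : BinaryTree ℕ} : rootLabel T = none ↔ T = .nil := by
  cases T <;> simp [rootLabel]

theorem isSmirnov_leaf {a : ℕ} {l : BinaryTree ℕ} :
    IsSmirnov (.node a l .nil) ↔ SatisfiesLocalConditions l ∧ rootLabel l ≠ some a := by
  simp [IsSmirnov, SatisfiesLocalConditions, LocalCondition, rootLabel, and_comm]

theorem isSmirnov_left {a : ℕ} {l r : BinaryTree ℕ} (h : rootLabel l = some a) :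
    IsSmirnov (.node a l r) ↔
      IsSmirnov l ∧ SatisfiesLocalConditions r ∧ ∃ c, rootLabel r = some c ∧ c < a := by
  have hl : l ≠ .nil := by rintro rfl; simp [rootLabel] at h
  simp only [IsSmirnov, SatisfiesLocalConditions, LocalCondition, h]
  constructor
  · rintro ⟨-, ⟨h1, -⟩, h2, h3⟩
    exact ⟨⟨hl, h2⟩, h3, by simpa using h1⟩
  · rintro ⟨⟨-, h2⟩, h3, c, hc, hca⟩
    refine ⟨by simp, ⟨fun _ => ⟨c, hc, hca⟩, fun h' => ?_⟩, h2, h3⟩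
    rw [hc] at h'
    simp at h'
    omega

theorem isSmirnov_right {a : ℕ} {l r : BinaryTree ℕ} (hr : r ≠ .nil) (h : rootLabel l ≠ some a) :
    IsSmirnov (.node a l r) ↔ SatisfiesLocalConditions l ∧ IsSmirnov r ∧
      (rootLabel r = some a → ∃ c, rootLabel l = some c ∧ a < c) := by
  simp only [IsSmirnov, SatisfiesLocalConditions, LocalCondition]
  tauto

/-- Each case carries exactly the facts that rebuild the Smirnov condition at the vertex after the
subtree continuing the path has been modified. -/
theorem IsSmirnov.pathInduction {motive : (T : BinaryTree ℕ) → IsSmirnov T → Prop}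
    (leaf : ∀ a l (hl : SatisfiesLocalConditions l) (hla : rootLabel l ≠ some a),
      motive (.node a l .nil) (isSmirnov_leaf.2 ⟨hl, hla⟩))
    (left : ∀ a l r (hla : rootLabel l = some a) (hl : IsSmirnov l)
      (hr : SatisfiesLocalConditions r) (hra : ∃ c, rootLabel r = some c ∧ c < a),
      motive l hl → motive (.node a l r) ((isSmirnov_left hla).2 ⟨hl, hr, hra⟩))
    (right : ∀ a l r (hla : rootLabel l ≠ some a) (hl : SatisfiesLocalConditions l)
      (hr : IsSmirnov r) (hra : rootLabel r = some a → ∃ c, rootLabel l = some c ∧ a < c),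
      motive r hr → motive (.node a l r) ((isSmirnov_right hr.1 hla).2 ⟨hl, hr, hra⟩))
    (T : BinaryTree ℕ) (hT : IsSmirnov T) : motive T hT := by
  induction T with
  | nil => exact absurd rfl hT.1
  | node a l r ihl ihr =>
    by_cases hr : r = .nil
    · subst hr
      exact leaf a l (isSmirnov_leaf.1 hT).1 (isSmirnov_leaf.1 hT).2
    · by_cases hl : rootLabel l = some a
      · obtain ⟨h1, h2, h3⟩ := (isSmirnov_left hl).1 hT
        exact left a l r hl h1 h2 h3 (ihl h1)
      · obtain ⟨h1, h2, h3⟩ := (isSmirnov_right hr hl).1 hT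
        exact right a l r hl h1 h2 h3 (ihr h2)

theorem ne_nil_of_rootLabel {T : BinaryTree ℕ} {c : ℕ} (h : rootLabel T = some c) :
    T ≠ .nil := by
  rintro rfl
  simp [rootLabel] at h

@[simp] theorem principalPath_leaf (a : ℕ) (l : BinaryTree ℕ) :
    principalPath (.node a l .nil) = [a] := by simp [principalPath]

theorem principalPath_left {a : ℕ} {l r : BinaryTree ℕ} (hr : r ≠ .nil)
    (h : rootLabel l = some a) :
    principalPath (.node a l r) = a :: principalPath l := by simp [principalPath, hr, h]

theorem principalPath_right {a : ℕ} {l r : BinaryTree ℕ} (hr : r ≠ .nil)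
    (h : rootLabel l ≠ some a) :
    principalPath (.node a l r) = a :: principalPath r := by simp [principalPath, hr, h]

theorem principalPath_eq_nil {T : BinaryTree ℕ} : principalPath T = [] ↔ T = .nil := by
  cases T with
  | nil => simp [principalPath]
  | node a l r => simp only [principalPath]; split_ifs <;> simp

theorem mem_principalPath_of_rootLabel {T : BinaryTree ℕ} {c : ℕ} (h : rootLabel T = some c) :
    c ∈ principalPath T := by
  cases T with
  | nil => simp [rootLabel] at h
  | node a l r =>
    simp only [rootLabel, Option.some.injEq] at h
    simp only [principalPath]
    split_ifs <;> simp [h]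

@[simp] theorem principalLabel_leaf (a : ℕ) (l : BinaryTree ℕ) :
    principalLabel (.node a l .nil) = a := by simp [principalLabel]

theorem principalLabel_left {a : ℕ} {l r : BinaryTree ℕ} (hr : r ≠ .nil)
    (h : rootLabel l = some a) : principalLabel (.node a l r) = principalLabel l := by
  have hl := mt principalPath_eq_nil.1 (ne_nil_of_rootLabel h)
  obtain ⟨b, t, hb⟩ := List.exists_cons_of_ne_nil hl
  simp [principalLabel, principalPath_left hr h, hb]

theorem principalLabel_right {a : ℕ} {l r : BinaryTree ℕ} (hr : r ≠ .nil)
    (h : rootLabel l ≠ some a) : principalLabel (.node a l r) = principalLabel r := by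
  have hl := mt principalPath_eq_nil.1 hr
  obtain ⟨b, t, hb⟩ := List.exists_cons_of_ne_nil hl
  simp [principalLabel, principalPath_right hr h, hb]

theorem principalLabel_mem {T : BinaryTree ℕ} (h : T ≠ .nil) :
    principalLabel T ∈ principalPath T := by
  obtain ⟨b, t, hb⟩ := List.exists_cons_of_ne_nil (mt principalPath_eq_nil.1 h)
  simp only [principalLabel, hb, List.getLastD_cons]
  cases t <;> simp [List.getLastD_eq_getLast?, List.getLast?_eq_getLast_of_ne_nil]

/-! ## Attaching a tree at the principal node -/

@[simp] theorem attach_leaf (a : ℕ) (l X : BinaryTree ℕ) :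
    attach (.node a l .nil) X = .node a l X := by simp [attach]

theorem attach_left {a : ℕ} {l r : BinaryTree ℕ} (hr : r ≠ .nil) (h : rootLabel l = some a)
    (X : BinaryTree ℕ) : attach (.node a l r) X = .node a (attach l X) r := by
  simp [attach, hr, h]

theorem attach_right {a : ℕ} {l r : BinaryTree ℕ} (hr : r ≠ .nil) (h : rootLabel l ≠ some a)
    (X : BinaryTree ℕ) : attach (.node a l r) X = .node a l (attach r X) := by
  simp [attach, hr, h]

@[simp] theorem rootLabel_attach (T X : BinaryTree ℕ) :
    rootLabel (attach T X) = rootLabel T := by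
  cases T with
  | nil => rfl
  | node a l r => simp only [attach]; split_ifs <;> rfl

theorem attach_ne_nil {T : BinaryTree ℕ} (h : T ≠ .nil) (X : BinaryTree ℕ) :
    attach T X ≠ .nil := by
  rwa [Ne, ← rootLabel_eq_none, rootLabel_attach, rootLabel_eq_none]

/-- Only the principal node gains a child. It had no right child, so its left child has a different
label, and the hypothesis on X excludes an equal label on the right; root labels along the path do
not change. -/
theorem IsSmirnov.attach {T X : BinaryTree ℕ} (hT : IsSmirnov T)
    (hX : SatisfiesLocalConditions X) (h : rootLabel X ≠ some (principalLabel T)) :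
    IsSmirnov (attach T X) := by
  induction T, hT using IsSmirnov.pathInduction with
  | leaf a l hl hla =>
    rw [attach_leaf]
    by_cases hX' : X = .nil
    · subst hX'; exact isSmirnov_leaf.2 ⟨hl, hla⟩
    · rw [principalLabel_leaf] at h
      exact (isSmirnov_right hX' hla).2 ⟨hl, ⟨hX', hX⟩, fun h' => absurd h' h⟩
  | left a l r hla hl hr hra ih =>
    obtain ⟨c, hc, hca⟩ := hra
    have hr' := ne_nil_of_rootLabel hc
    rw [principalLabel_left hr' hla] at h
    rw [attach_left hr' hla]
    exact (isSmirnov_left (by simpa using hla)).2 ⟨ih h, hr, c, hc, hca⟩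
  | right a l r hla hl hr hra ih =>
    rw [principalLabel_right hr.1 hla] at h
    rw [attach_right hr.1 hla]
    exact (isSmirnov_right (attach_ne_nil hr.1 X) hla).2 ⟨hl, ih h, by simpa using hra⟩

theorem leftEdgeWeight_congr {a : ℕ} {l l' : BinaryTree ℕ} (h : rootLabel l = rootLabel l') :
    leftEdgeWeight a l = leftEdgeWeight a l' := by
  simp [leftEdgeWeight, h]

theorem rightEdgeWeight_congr {a : ℕ} {r r' : BinaryTree ℕ} (h : rootLabel r = rootLabel r') :
    rightEdgeWeight a r = rightEdgeWeight a r' := by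
  simp [rightEdgeWeight, h]

@[simp] theorem leftEdgeWeight_nil (a : ℕ) : leftEdgeWeight a .nil = 1 := rfl

@[simp] theorem rightEdgeWeight_nil (a : ℕ) : rightEdgeWeight a .nil = 1 := rfl

theorem leftEdgeWeight_of_rootLabel {a c : ℕ} {l : BinaryTree ℕ} (h : rootLabel l = some c) :
    leftEdgeWeight a l = if c ≤ a then edge .lamBar else edge .lam := by
  simp [leftEdgeWeight, h]

theorem rightEdgeWeight_of_rootLabel {a c : ℕ} {r : BinaryTree ℕ} (h : rootLabel r = some c) :
    rightEdgeWeight a r = if a ≤ c then edge .rhoBar else edge .rho := by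
  simp [rightEdgeWeight, h]

theorem leftEdgeWeight_node (a c : ℕ) (l r : BinaryTree ℕ) :
    leftEdgeWeight a (.node c l r) = if c ≤ a then edge .lamBar else edge .lam := rfl

theorem rightEdgeWeight_node (a c : ℕ) (l r : BinaryTree ℕ) :
    rightEdgeWeight a (.node c l r) = if a ≤ c then edge .rhoBar else edge .rho := rfl

theorem IsSmirnov.weight_attach {T : BinaryTree ℕ} (hT : IsSmirnov T) (X : BinaryTree ℕ) :
    weight (Smirnov.attach T X) =
      weight T * rightEdgeWeight (principalLabel T) X * weight X := by
  induction T, hT using IsSmirnov.pathInduction with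
  | leaf a l hl hla =>
    rw [attach_leaf, principalLabel_leaf, weight, weight, rightEdgeWeight_nil, weight]
    ring
  | left a l r hla hl hr hra ih =>
    obtain ⟨c, hc, hca⟩ := hra
    have hr' := ne_nil_of_rootLabel hc
    rw [attach_left hr' hla, principalLabel_left hr' hla, weight, weight, ih,
      leftEdgeWeight_congr (rootLabel_attach l X)]
    ring
  | right a l r hla hl hr hra ih =>
    rw [attach_right hr.1 hla, principalLabel_right hr.1 hla, weight, weight, ih,
      rightEdgeWeight_congr (rootLabel_attach r X)]
    ring

theorem numNodes_le_attach (T X : BinaryTree ℕ) : T.numNodes ≤ (attach T X).numNodes := by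
  induction T with
  | nil => simp [attach]
  | node a l r ihl ihr =>
    simp only [attach]
    split_ifs with h1 h2
    · simp [BinaryTree.numNodes, h1]
    · simp only [BinaryTree.numNodes]; omega
    · simp only [BinaryTree.numNodes]; omega

/-- A Smirnov tree decomposes along its principal path at the first label satisfying `p`. -/
theorem IsSmirnov.exists_attach (p : ℕ → Prop) {T : BinaryTree ℕ} (hT : IsSmirnov T)
    (hp : ∀ c, rootLabel T = some c → ¬ p c) :
    ∃ T' X, IsSmirnov T' ∧ SatisfiesLocalConditions X ∧ (∀ y ∈ principalPath T', ¬ p y) ∧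
      (∀ c, rootLabel X = some c → p c) ∧ Smirnov.attach T' X = T := by
  induction T, hT using IsSmirnov.pathInduction with
  | leaf a l hl hla =>
    refine ⟨.node a l .nil, .nil, isSmirnov_leaf.2 ⟨hl, hla⟩, trivial, ?_, ?_, by simp⟩
    · simpa [rootLabel] using hp
    · simp [rootLabel]
  | left a l r hla hl hr hra ih =>
    obtain ⟨T', X, h1, h2, h3, h4, rfl⟩ := ih (fun c hc => hp c (by rw [← hc, hla, rootLabel]))
    obtain ⟨c, hc, hca⟩ := hra
    have hr' := ne_nil_of_rootLabel hc
    rw [rootLabel_attach] at hla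
    refine ⟨.node a T' r, X, (isSmirnov_left hla).2 ⟨h1, hr, c, hc, hca⟩, h2, ?_, h4,
      attach_left hr' hla X⟩
    rw [principalPath_left hr' hla]
    exact List.forall_mem_cons.2 ⟨hp a rfl, h3⟩
  | right a l r hla hl hr hra ih =>
    -- Cuts occur only at right edges: a left step of the path keeps the label, so it cannot be
    -- where `p` first holds.
    by_cases hpr : ∃ c, rootLabel r = some c ∧ p c
    · obtain ⟨c, hc, hpc⟩ := hpr
      refine ⟨.node a l .nil, r, isSmirnov_leaf.2 ⟨hl, hla⟩, hr.2, ?_, ?_, by simp⟩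
      · simpa [rootLabel] using hp
      · simp [hc, hpc]
    · push Not at hpr
      obtain ⟨T', X, h1, h2, h3, h4, rfl⟩ := ih hpr
      rw [rootLabel_attach] at hra
      refine ⟨.node a l T', X, (isSmirnov_right h1.1 hla).2 ⟨hl, h1, hra⟩, h2, ?_, h4,
        attach_right h1.1 hla X⟩
      rw [principalPath_right h1.1 hla]
      exact List.forall_mem_cons.2 ⟨hp a rfl, h3⟩

/-- The decomposition of a Smirnov tree at the first label satisfying `p` is unique. -/
theorem IsSmirnov.attach_inj (p : ℕ → Prop) {T U X Y : BinaryTree ℕ} (hT : IsSmirnov T)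
    (hU : IsSmirnov U) (hpT : ∀ y ∈ principalPath T, ¬ p y) (hpU : ∀ y ∈ principalPath U, ¬ p y)
    (hX : ∀ c, rootLabel X = some c → p c) (hY : ∀ c, rootLabel Y = some c → p c)
    (h : Smirnov.attach T X = Smirnov.attach U Y) : T = U ∧ X = Y := by
  -- If one path were cut earlier than the other, the piece removed there would begin with a vertex
  -- of the other path: its root label would both satisfy and violate `p`.
  have key : ∀ {r Z Z' : BinaryTree ℕ}, IsSmirnov r → (∀ y ∈ principalPath r, ¬ p y) →
      (∀ c, rootLabel Z = some c → p c) → Z ≠ Smirnov.attach r Z' := by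
    rintro r Z Z' hr hpr hZ rfl
    cases hc : rootLabel r with
    | none => exact hr.1 (rootLabel_eq_none.1 hc)
    | some c =>
      exact hpr c (mem_principalPath_of_rootLabel hc) (hZ c (by rw [rootLabel_attach, hc]))
  induction T, hT using IsSmirnov.pathInduction generalizing U with
  | leaf a l hl hla =>
    induction U, hU using IsSmirnov.pathInduction with
    | leaf a' l' hl' hla' => simpa [and_assoc] using h
    | left a' l' r' hla' hl' hr' hra' _ =>
      obtain ⟨c, hc, hca⟩ := hra'
      rw [attach_leaf, attach_left (ne_nil_of_rootLabel hc) hla'] at h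
      simp only [BinaryTree.node.injEq] at h
      obtain ⟨rfl, rfl, rfl⟩ := h
      simp [hla'] at hla
    | right a' l' r' hla' hl' hr' hra' _ =>
      rw [attach_leaf, attach_right hr'.1 hla'] at h
      rw [principalPath_right hr'.1 hla'] at hpU
      simp only [BinaryTree.node.injEq] at h
      exact absurd h.2.2 (key hr' (fun y hy => hpU y (by simp [hy])) hX)
  | left a l r hla hl hr hra ih =>
    obtain ⟨c, hc, hca⟩ := hra
    have hr0 := ne_nil_of_rootLabel hc
    rw [attach_left hr0 hla] at h
    rw [principalPath_left hr0 hla] at hpT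
    induction U, hU using IsSmirnov.pathInduction with
    | leaf a' l' hl' hla' =>
      simp only [attach_leaf, BinaryTree.node.injEq] at h
      obtain ⟨rfl, rfl, rfl⟩ := h
      simp [hla] at hla'
    | left a' l' r' hla' hl' hr' hra' _ =>
      obtain ⟨c', hc', hca'⟩ := hra'
      rw [attach_left (ne_nil_of_rootLabel hc') hla'] at h
      rw [principalPath_left (ne_nil_of_rootLabel hc') hla'] at hpU
      simp only [BinaryTree.node.injEq] at h
      obtain ⟨rfl, h, rfl⟩ := h
      obtain ⟨rfl, rfl⟩ := ih hl' (fun y hy => hpT y (by simp [hy]))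
        (fun y hy => hpU y (by simp [hy])) h
      simp
    | right a' l' r' hla' hl' hr' hra' _ =>
      rw [attach_right hr'.1 hla'] at h
      simp only [BinaryTree.node.injEq] at h
      obtain ⟨rfl, rfl, rfl⟩ := h
      simp [hla] at hla'
  | right a l r hla hl hr hra ih =>
    rw [attach_right hr.1 hla] at h
    rw [principalPath_right hr.1 hla] at hpT
    induction U, hU using IsSmirnov.pathInduction with
    | leaf a' l' hl' hla' =>
      simp only [attach_leaf, BinaryTree.node.injEq] at h
      exact absurd h.2.2.symm (key hr (fun y hy => hpT y (by simp [hy])) hY)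
    | left a' l' r' hla' hl' hr' hra' _ =>
      obtain ⟨c', hc', hca'⟩ := hra'
      rw [attach_left (ne_nil_of_rootLabel hc') hla'] at h
      simp only [BinaryTree.node.injEq] at h
      obtain ⟨rfl, rfl, rfl⟩ := h
      simp [hla'] at hla
    | right a' l' r' hla' hl' hr' hra' _ =>
      rw [attach_right hr'.1 hla'] at h
      rw [principalPath_right hr'.1 hla'] at hpU
      simp only [BinaryTree.node.injEq] at h
      obtain ⟨rfl, rfl, h⟩ := h
      obtain ⟨rfl, rfl⟩ := ih hr' (fun y hy => hpT y (by simp [hy]))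
        (fun y hy => hpU y (by simp [hy])) h
      simp

/-! ## The graph of the map `Φ` -/

/-- The tree underlying a step, empty for `D` and `U`. -/
def Step.subtree : Step → BinaryTree ℕ
  | .D => .nil
  | .U => .nil
  | .tree S => S.1

theorem Step.satisfiesLocalConditions_subtree (S : Step) :
    SatisfiesLocalConditions S.subtree := by
  cases S with
  | D => trivial
  | U => trivial
  | tree S => exact S.2.2

/-- `D` and `U` share the empty subtree; once one of them is excluded, the subtree determines the
step. -/
theorem Step.eq_of_ne_D {S R : Step} (hS : S ≠ .D) (hR : R ≠ .D) (h : S.subtree = R.subtree) :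
    S = R := by
  cases S <;> cases R <;> simp_all [Step.subtree]
  · rename_i S; exact S.2.1 h.symm
  · rename_i S; exact S.2.1 h
  · exact Subtype.ext h

theorem Step.eq_of_ne_U {S R : Step} (hS : S ≠ .U) (hR : R ≠ .U) (h : S.subtree = R.subtree) :
    S = R := by
  cases S <;> cases R <;> simp_all [Step.subtree]
  · rename_i S; exact S.2.1 h.symm
  · rename_i S; exact S.2.1 h
  · exact Subtype.ext h

theorem Step.exists_ne_D {X : BinaryTree ℕ} (hX : SatisfiesLocalConditions X) :
    ∃ S : Step, S ≠ .D ∧ S.subtree = X := by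
  by_cases h : X = .nil
  · exact ⟨.U, by simp, h.symm⟩
  · exact ⟨.tree ⟨X, h, hX⟩, by simp, rfl⟩

theorem Step.exists_ne_U {X : BinaryTree ℕ} (hX : SatisfiesLocalConditions X) :
    ∃ S : Step, S ≠ .U ∧ S.subtree = X := by
  by_cases h : X = .nil
  · exact ⟨.D, by simp, h.symm⟩
  · exact ⟨.tree ⟨X, h, hX⟩, by simp, rfl⟩

/-- The labels on the principal path of `T` are below `b`, and the root of `X` is not. -/
def SepLow (b : ℕ) (T X : BinaryTree ℕ) : Prop :=
  (∀ y ∈ principalPath T, y < b) ∧ ∀ c, rootLabel X = some c → b ≤ c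

/-- The labels on the principal path of `T` are above `b`, and the root of `X` is not. -/
def SepHigh (b : ℕ) (T X : BinaryTree ℕ) : Prop :=
  (∀ y ∈ principalPath T, b < y) ∧ ∀ c, rootLabel X = some c → c ≤ b

/-- The labels `a` and `c` are on the same side of `b`. -/
def SameSide (a b c : ℕ) : Prop := (a < b ∧ c < b) ∨ (b < a ∧ b < c)

/-- The relation `Φ(T, S, b) = T'`, by recursion along the principal path of `T`. -/
inductive Inserts (b : ℕ) : BinaryTree ℕ → Step → BinaryTree ℕ → Prop
  | base (a l S) : IsSmirnov (.node a l .nil) → S ≠ .U → a ≠ b →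
      (∀ c, rootLabel S.subtree = some c → SameSide a b c) →
      Inserts b (.node a l .nil) S (.node a l (.node b S.subtree .nil))
  | root (T S) : IsSmirnov T → S ≠ .D → SepLow b T S.subtree ∨ SepHigh b T S.subtree →
      Inserts b T S (.node b (attach T S.subtree) .nil)
  | mid (d l r S) : IsSmirnov (.node d l r) → rootLabel l ≠ some d → r ≠ .nil → S ≠ .D →
      b < d ∧ SepLow b r S.subtree ∨ d < b ∧ SepHigh b r S.subtree →
      Inserts b (.node d l r) S (.node d l (.node b (attach r S.subtree) .nil))
  | equalLow (l r S) : IsSmirnov (.node b l r) → rootLabel l ≠ some b → r ≠ .nil → S ≠ .D →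
      SepLow b r S.subtree →
      Inserts b (.node b l r) S (.node b (.node b l .nil) (attach r S.subtree))
  | equalHigh (l r S) : IsSmirnov (.node b l r) → rootLabel l ≠ some b → r ≠ .nil → S ≠ .D →
      SepHigh b r S.subtree →
      Inserts b (.node b l r) S (.node b (attach r S.subtree) (.node b l .nil))
  -- The last hypothesis of each recursive constructor prevents β from becoming the root of the
  -- subtree. In that case β must be placed higher up.
  | left (a l r S l') : IsSmirnov (.node a l r) → rootLabel l = some a → Inserts b l S l' →
      rootLabel l' = some a → Inserts b (.node a l r) S (.node a l' r)
  | right (a l r S r') : IsSmirnov (.node a l r) → rootLabel l ≠ some a → r ≠ .nil →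
      Inserts b r S r' → rootLabel r' = rootLabel r → Inserts b (.node a l r) S (.node a l r')

theorem ne_nil_of_isSmirnov_left {a : ℕ} {l r : BinaryTree ℕ} (h : rootLabel l = some a)
    (hT : IsSmirnov (.node a l r)) : r ≠ .nil := by
  obtain ⟨-, -, c, hc, -⟩ := (isSmirnov_left h).1 hT
  exact ne_nil_of_rootLabel hc

/-! ### Separated pairs: gluing and unique cutting -/

theorem SepLow.lt {b c : ℕ} {T X : BinaryTree ℕ} (h : SepLow b T X) (hc : rootLabel T = some c) :
    c < b := h.1 c (mem_principalPath_of_rootLabel hc)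

theorem SepHigh.lt {b c : ℕ} {T X : BinaryTree ℕ} (h : SepHigh b T X)
    (hc : rootLabel T = some c) : b < c := h.1 c (mem_principalPath_of_rootLabel hc)

theorem SepLow.rootLabel_ne {b : ℕ} {T X : BinaryTree ℕ} (h : SepLow b T X) :
    rootLabel T ≠ some b := fun hc => (h.lt hc).false

theorem SepHigh.rootLabel_ne {b : ℕ} {T X : BinaryTree ℕ} (h : SepHigh b T X) :
    rootLabel T ≠ some b := fun hc => (h.lt hc).false

theorem SepLow.isSmirnov {b : ℕ} {T X : BinaryTree ℕ} (h : SepLow b T X) (hT : IsSmirnov T)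
    (hX : SatisfiesLocalConditions X) : IsSmirnov (attach T X) :=
  hT.attach hX fun hc =>
    absurd (h.2 _ hc) (not_le.2 (h.1 _ (principalLabel_mem hT.1)))

theorem SepHigh.isSmirnov {b : ℕ} {T X : BinaryTree ℕ} (h : SepHigh b T X) (hT : IsSmirnov T)
    (hX : SatisfiesLocalConditions X) : IsSmirnov (attach T X) :=
  hT.attach hX fun hc =>
    absurd (h.2 _ hc) (not_le.2 (h.1 _ (principalLabel_mem hT.1)))

theorem SepLow.attach_inj {b : ℕ} {T U X Y : BinaryTree ℕ} (hT : IsSmirnov T) (hU : IsSmirnov U)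
    (h : SepLow b T X) (h' : SepLow b U Y) (e : attach T X = attach U Y) : T = U ∧ X = Y :=
  hT.attach_inj (b ≤ ·) hU (fun y hy => not_le.2 (h.1 y hy)) (fun y hy => not_le.2 (h'.1 y hy))
    h.2 h'.2 e

theorem SepHigh.attach_inj {b : ℕ} {T U X Y : BinaryTree ℕ} (hT : IsSmirnov T)
    (hU : IsSmirnov U) (h : SepHigh b T X) (h' : SepHigh b U Y) (e : attach T X = attach U Y) :
    T = U ∧ X = Y :=
  hT.attach_inj (· ≤ b) hU (fun y hy => not_le.2 (h.1 y hy)) (fun y hy => not_le.2 (h'.1 y hy))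
    h.2 h'.2 e

/-- The root label shows the side: attaching leaves it unchanged, and it lies strictly below b in
one case and strictly above in the other. -/
theorem SepLow.not_sepHigh {b : ℕ} {T U X Y : BinaryTree ℕ} (hT : T ≠ .nil) (h : SepLow b T X)
    (h' : SepHigh b U Y) : attach T X ≠ attach U Y := by
  intro e
  have e' := congrArg rootLabel e
  simp only [rootLabel_attach] at e'
  cases hc : rootLabel T with
  | none => exact hT (rootLabel_eq_none.1 hc)
  | some c => exact (h.lt hc).asymm (h'.lt (e' ▸ hc))

theorem attach_inj_of_sep {b : ℕ} {T U X Y : BinaryTree ℕ} (hT : IsSmirnov T)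
    (hU : IsSmirnov U) (h : SepLow b T X ∨ SepHigh b T X) (h' : SepLow b U Y ∨ SepHigh b U Y)
    (e : attach T X = attach U Y) : T = U ∧ X = Y := by
  rcases h with h | h <;> rcases h' with h' | h'
  · exact h.attach_inj hT hU h' e
  · exact absurd e (h.not_sepHigh hT.1 h')
  · exact absurd e.symm (h'.not_sepHigh hU.1 h)
  · exact h.attach_inj hT hU h' e

theorem IsSmirnov.exists_sepLow {b c : ℕ} {T : BinaryTree ℕ} (hT : IsSmirnov T)
    (hc : rootLabel T = some c) (h : c < b) :
    ∃ (T' : BinaryTree ℕ) (S : Step), S ≠ .D ∧ IsSmirnov T' ∧ SepLow b T' S.subtree ∧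
      Smirnov.attach T' S.subtree = T := by
  obtain ⟨T', X, h1, h2, h3, h4, h5⟩ := hT.exists_attach (b ≤ ·) (by simp [hc, h])
  obtain ⟨S, hS, rfl⟩ := Step.exists_ne_D h2
  exact ⟨T', S, hS, h1, ⟨fun y hy => not_le.1 (h3 y hy), h4⟩, h5⟩

theorem IsSmirnov.exists_sepHigh {b c : ℕ} {T : BinaryTree ℕ} (hT : IsSmirnov T)
    (hc : rootLabel T = some c) (h : b < c) :
    ∃ (T' : BinaryTree ℕ) (S : Step), S ≠ .D ∧ IsSmirnov T' ∧ SepHigh b T' S.subtree ∧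
      Smirnov.attach T' S.subtree = T := by
  obtain ⟨T', X, h1, h2, h3, h4, h5⟩ := hT.exists_attach (· ≤ b) (by simp [hc, h])
  obtain ⟨S, hS, rfl⟩ := Step.exists_ne_D h2
  exact ⟨T', S, hS, h1, ⟨fun y hy => not_le.1 (h3 y hy), h4⟩, h5⟩

/-! ### Smirnov condition, principal label and size after an insertion -/

namespace Inserts

variable {b : ℕ} {S R : Step} {T T' U V : BinaryTree ℕ}

theorem isSmirnov_source (h : Inserts b T S T') : IsSmirnov T := by
  cases h <;> assumption

theorem isSmirnov (h : Inserts b T S T') : IsSmirnov T' := by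
  have hloc := S.satisfiesLocalConditions_subtree
  induction h with
  | base a l S hT hS hab hc =>
    obtain ⟨hl, hla⟩ := isSmirnov_leaf.1 hT
    refine (isSmirnov_right (by simp) hla).2 ⟨hl, isSmirnov_leaf.2 ⟨hloc, fun h => ?_⟩, ?_⟩
    · have := hc b h
      simp [SameSide] at this
    · simp [rootLabel, hab.symm]
  | root T S hT hS hsep =>
    rw [isSmirnov_leaf, rootLabel_attach]
    rcases hsep with h | h
    · exact ⟨(h.isSmirnov hT hloc).2, h.rootLabel_ne⟩
    · exact ⟨(h.isSmirnov hT hloc).2, h.rootLabel_ne⟩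
  | mid d l r S hT hl hr hS hsep =>
    obtain ⟨h1, h2, h3⟩ := (isSmirnov_right hr hl).1 hT
    have hbd : b ≠ d := by omega
    refine (isSmirnov_right (by simp) hl).2 ⟨h1, ?_, by simp [rootLabel, hbd]⟩
    rw [isSmirnov_leaf, rootLabel_attach]
    rcases hsep with ⟨-, h⟩ | ⟨-, h⟩
    · exact ⟨(h.isSmirnov h2 hloc).2, h.rootLabel_ne⟩
    · exact ⟨(h.isSmirnov h2 hloc).2, h.rootLabel_ne⟩
  | equalLow l r S hT hl hr hS hsep =>
    obtain ⟨h1, h2, h3⟩ := (isSmirnov_right hr hl).1 hT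
    obtain ⟨c, hc⟩ := Option.ne_none_iff_exists'.1 (mt rootLabel_eq_none.1 hr)
    exact (isSmirnov_left (by simp [rootLabel])).2
      ⟨isSmirnov_leaf.2 ⟨h1, hl⟩, (hsep.isSmirnov h2 hloc).2, c, by simpa using hc, hsep.lt hc⟩
  | equalHigh l r S hT hl hr hS hsep =>
    obtain ⟨h1, h2, h3⟩ := (isSmirnov_right hr hl).1 hT
    obtain ⟨c, hc⟩ := Option.ne_none_iff_exists'.1 (mt rootLabel_eq_none.1 hr)
    refine (isSmirnov_right (by simp) (by simpa using hsep.rootLabel_ne)).2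
      ⟨(hsep.isSmirnov h2 hloc).2, isSmirnov_leaf.2 ⟨h1, hl⟩, fun _ =>
        ⟨c, by simpa using hc, hsep.lt hc⟩⟩
  | left a l r S l' hT hl _ hl' ih =>
    exact (isSmirnov_left hl').2 ⟨ih hloc, ((isSmirnov_left hl).1 hT).2⟩
  | right a l r S r' hT hl hr _ hr' ih =>
    obtain ⟨h1, h2, h3⟩ := (isSmirnov_right hr hl).1 hT
    exact (isSmirnov_right (ih hloc).1 hl).2 ⟨h1, ih hloc, by rwa [hr']⟩

theorem principalLabel_eq (h : Inserts b T S T') : principalLabel T' = b := by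
  induction h with
  | base a l S hT hS hab hc =>
    rw [principalLabel_right (by simp) (isSmirnov_leaf.1 hT).2, principalLabel_leaf]
  | root T S hT hS hsep => rw [principalLabel_leaf]
  | mid d l r S hT hl hr hS hsep => rw [principalLabel_right (by simp) hl, principalLabel_leaf]
  | equalLow l r S hT hl hr hS hsep =>
    rw [principalLabel_left (attach_ne_nil hr _) rfl, principalLabel_leaf]
  | equalHigh l r S hT hl hr hS hsep =>
    rw [principalLabel_right (by simp) (by simpa using hsep.rootLabel_ne), principalLabel_leaf]
  | left a l r S l' hT hl _ hl' ih =>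
    rwa [principalLabel_left (ne_nil_of_isSmirnov_left hl hT) hl']
  | right a l r S r' hT hl hr h hr' ih => rwa [principalLabel_right h.isSmirnov.1 hl]

theorem numNodes_lt (h : Inserts b T S T') : T.numNodes < T'.numNodes := by
  induction h with
  | base a l S hT hS hab hc => simp [BinaryTree.numNodes]
  | root T S hT hS hsep =>
    have := numNodes_le_attach T S.subtree
    simp only [BinaryTree.numNodes]; omega
  | mid d l r S hT hl hr hS hsep =>
    have := numNodes_le_attach r S.subtree
    simp only [BinaryTree.numNodes]; omega
  | equalLow l r S hT hl hr hS hsep =>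
    have := numNodes_le_attach r S.subtree
    simp only [BinaryTree.numNodes]; omega
  | equalHigh l r S hT hl hr hS hsep =>
    have := numNodes_le_attach r S.subtree
    simp only [BinaryTree.numNodes]; omega
  | left a l r S l' hT hl _ hl' ih => simp only [BinaryTree.numNodes]; omega
  | right a l r S r' hT hl hr _ hr' ih => simp only [BinaryTree.numNodes]; omega

/-! ### Weights -/

/-- The step pays for the new edge from α to β and, when there is a tree S, for the edge from β to
S. Being on the same side of b makes both edges barred or both unbarred. -/
theorem _root_.Smirnov.stepWeight_of_ne_U {a b : ℕ} {S : Step} (hS : S ≠ .U)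
    (hab : a ≠ b) (h : ∀ c, rootLabel S.subtree = some c → SameSide a b c) :
    stepWeight a b S = (if a ≤ b then edge .rhoBar else edge .rho) *
      leftEdgeWeight b S.subtree * weight S.subtree := by
  have hle : a ≤ b ↔ a < b := by omega
  cases S with
  | D => simp [stepWeight, Step.subtree, weight, hle]
  | U => exact absurd rfl hS
  | tree S =>
    obtain ⟨c, hc⟩ := Option.ne_none_iff_exists'.1 (mt rootLabel_eq_none.1 S.2.1)
    have := h c hc
    simp only [Step.subtree, stepWeight, leftEdgeWeight_of_rootLabel hc, hle]
    rcases this with ⟨h1, h2⟩ | ⟨h1, h2⟩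
    · rw [if_pos h1, if_pos h1, if_pos h2.le]; ring
    · rw [if_neg h1.not_gt, if_neg h1.not_gt, if_neg h2.not_ge]; ring

/-- Under rules 2–5 the step pays for a new left edge of weight λ̄ and for the right edge from α to
S, barred because a < b ≤ c. -/
theorem _root_.Smirnov.stepWeight_of_sepLow {b : ℕ} {T : BinaryTree ℕ} {S : Step} (hT : T ≠ .nil)
    (hS : S ≠ .D) (h : SepLow b T S.subtree) :
    stepWeight (principalLabel T) b S = edge .lamBar *
      rightEdgeWeight (principalLabel T) S.subtree * weight S.subtree := by
  have ha := h.1 _ (principalLabel_mem hT)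
  cases S with
  | D => exact absurd rfl hS
  | U => simp [stepWeight, Step.subtree, weight, ha]
  | tree S =>
    obtain ⟨c, hc⟩ := Option.ne_none_iff_exists'.1 (mt rootLabel_eq_none.1 S.2.1)
    have := h.2 c hc
    simp only [Step.subtree, stepWeight, rightEdgeWeight_of_rootLabel hc]
    rw [if_pos ha, if_pos (ha.le.trans this)]

theorem _root_.Smirnov.stepWeight_of_sepHigh {b : ℕ} {T : BinaryTree ℕ} {S : Step}
    (hT : T ≠ .nil) (hS : S ≠ .D) (h : SepHigh b T S.subtree) :
    stepWeight (principalLabel T) b S = edge .lam *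
      rightEdgeWeight (principalLabel T) S.subtree * weight S.subtree := by
  have ha := h.1 _ (principalLabel_mem hT)
  cases S with
  | D => exact absurd rfl hS
  | U => simp [stepWeight, Step.subtree, weight, ha.not_gt]
  | tree S =>
    obtain ⟨c, hc⟩ := Option.ne_none_iff_exists'.1 (mt rootLabel_eq_none.1 S.2.1)
    have := h.2 c hc
    simp only [Step.subtree, stepWeight, rightEdgeWeight_of_rootLabel hc]
    rw [if_neg ha.not_gt, if_neg (not_le.2 (this.trans_lt ha))]

theorem weight_eq (h : Inserts b T S T') :
    weight T' = weight T * x b * stepWeight (principalLabel T) b S := by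
  induction h with
  | base a l S hT hS hab hc =>
    rw [principalLabel_leaf, stepWeight_of_ne_U hS hab hc]
    simp only [weight, rightEdgeWeight_nil, rightEdgeWeight_node]
    ring
  | root T S hT hS hsep =>
    obtain ⟨c, hc⟩ := Option.ne_none_iff_exists'.1 (mt rootLabel_eq_none.1 hT.1)
    simp only [weight, rightEdgeWeight_nil, hT.weight_attach,
      leftEdgeWeight_of_rootLabel ((rootLabel_attach T _).trans hc)]
    rcases hsep with h | h
    · rw [stepWeight_of_sepLow hT.1 hS h, if_pos (h.lt hc).le]; ring
    · rw [stepWeight_of_sepHigh hT.1 hS h, if_neg (h.lt hc).not_ge]; ring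
  | mid d l r S hT hl hr hS hsep =>
    obtain ⟨h1, h2, h3⟩ := (isSmirnov_right hr hl).1 hT
    obtain ⟨c, hc⟩ := Option.ne_none_iff_exists'.1 (mt rootLabel_eq_none.1 hr)
    rw [principalLabel_right hr hl]
    simp only [weight, rightEdgeWeight_nil, h2.weight_attach,
      leftEdgeWeight_of_rootLabel ((rootLabel_attach r _).trans hc),
      rightEdgeWeight_of_rootLabel hc, rightEdgeWeight_node]
    -- The old right child of δ and β lie on the same side of d, so the right edge at δ keeps its
    -- weight; the left edge of β is new.
    rcases hsep with ⟨hb, h⟩ | ⟨hb, h⟩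
    · have := h.lt hc
      rw [stepWeight_of_sepLow h2.1 hS h, if_pos this.le, if_neg hb.not_ge,
        if_neg (this.trans hb).not_ge]; ring
    · have := h.lt hc
      rw [stepWeight_of_sepHigh h2.1 hS h, if_neg this.not_ge, if_pos hb.le,
        if_pos (hb.trans this).le]; ring
  | equalLow l r S hT hl hr hS hsep =>
    obtain ⟨h1, h2, h3⟩ := (isSmirnov_right hr hl).1 hT
    rw [principalLabel_right hr hl, stepWeight_of_sepLow h2.1 hS hsep]
    simp only [weight, rightEdgeWeight_nil, h2.weight_attach,
      leftEdgeWeight_node, rightEdgeWeight_congr (rootLabel_attach r _)]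
    rw [if_pos le_rfl]; ring
  | equalHigh l r S hT hl hr hS hsep =>
    obtain ⟨h1, h2, h3⟩ := (isSmirnov_right hr hl).1 hT
    obtain ⟨c, hc⟩ := Option.ne_none_iff_exists'.1 (mt rootLabel_eq_none.1 hr)
    have := hsep.lt hc
    rw [principalLabel_right hr hl, stepWeight_of_sepHigh h2.1 hS hsep]
    simp only [weight, rightEdgeWeight_nil, h2.weight_attach,
      leftEdgeWeight_of_rootLabel ((rootLabel_attach r _).trans hc),
      rightEdgeWeight_of_rootLabel hc, rightEdgeWeight_node]
    -- The right edge to β replaces the old right edge, both of weight ρ̄; the old left edge now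
    -- hangs from β, which has the same label; the new left edge of δ has weight λ.
    rw [if_pos le_rfl, if_neg this.not_ge, if_pos this.le]; ring
  | left a l r S l' hT hl _ hl' ih =>
    rw [principalLabel_left (ne_nil_of_isSmirnov_left hl hT) hl, weight, weight, ih,
      leftEdgeWeight_congr (hl'.trans hl.symm)]
    ring
  | right a l r S r' hT hl hr h hr' ih =>
    rw [principalLabel_right hr hl, weight, weight, ih, rightEdgeWeight_congr hr']
    ring

/-! ### Existence and uniqueness of preimages -/

/-- Together with `right_ne_nil`, this detects a new root from the result alone: the root lacks a
right child exactly when β was placed there. -/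
theorem rootLabel_eq {c : ℕ} {l r : BinaryTree ℕ} (h : Inserts b T S (.node c l r))
    (hr : r ≠ .nil) : rootLabel T = some c := by
  cases h <;> first | rfl | exact absurd rfl hr

theorem right_ne_nil {c : ℕ} {l r : BinaryTree ℕ} (h : Inserts b T S (.node c l r))
    (hT : rootLabel T = some c) : r ≠ .nil := by
  cases h with
  | base => simp
  | root _ _ _ _ hsep =>
    rcases hsep with h | h
    · exact absurd hT h.rootLabel_ne
    · exact absurd hT h.rootLabel_ne
  | mid => simp
  | equalLow _ _ _ _ _ hr => exact attach_ne_nil hr _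
  | equalHigh => simp
  | left _ _ _ _ _ hU hl => exact ne_nil_of_isSmirnov_left hl hU
  | right _ _ _ _ _ _ _ _ h _ => exact h.isSmirnov.1

end Inserts

/-- The vertex to remove is the last vertex β of the principal path. The rule that placed it is read
off from β, its parent and its left child: no parent is rule 2; a left child β is rule 4; a right
child with the parent's label is rule 5; any other right child is rule 1 or 3, according to whether
the parent and the left child of β, if any, lie on the same side of β. -/
theorem IsSmirnov.exists_inserts {V : BinaryTree ℕ} (hV : IsSmirnov V) :
    (∃ a, V = .node a .nil .nil) ∨ ∃ b T S, Inserts b T S V := by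
  induction V, hV using IsSmirnov.pathInduction with
  | leaf a l hl hla =>
    cases hc : rootLabel l with
    | none => exact .inl ⟨a, by rw [rootLabel_eq_none.1 hc]⟩
    | some c =>
      right
      have hl' : IsSmirnov l := ⟨ne_nil_of_rootLabel hc, hl⟩
      rcases lt_or_gt_of_ne (show c ≠ a by rintro rfl; exact hla hc) with h | h
      · obtain ⟨T, S, h1, h2, h3, rfl⟩ := hl'.exists_sepLow hc h
        exact ⟨a, T, S, .root T S h2 h1 (.inl h3)⟩
      · obtain ⟨T, S, h1, h2, h3, rfl⟩ := hl'.exists_sepHigh hc h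
        exact ⟨a, T, S, .root T S h2 h1 (.inr h3)⟩
  | left a l r hla hl hr hra ih =>
    right
    obtain ⟨c, hc, hca⟩ := hra
    have hr' : IsSmirnov r := ⟨ne_nil_of_rootLabel hc, hr⟩
    cases l with
    | nil => simp [rootLabel] at hla
    | node a' l' r' =>
      obtain rfl : a' = a := by simpa [rootLabel] using hla
      -- A left child with no right child ends the path, so it is β itself; otherwise β lies deeper.
      by_cases hr0 : r' = .nil
      · subst hr0
        obtain ⟨h4, h5⟩ := isSmirnov_leaf.1 hl
        obtain ⟨T, S, h1, h2, h3, rfl⟩ := hr'.exists_sepLow hc hca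
        exact ⟨a', .node a' l' T, S, .equalLow l' T S ((isSmirnov_right h2.1 h5).2
          ⟨h4, h2, fun h => absurd h h3.rootLabel_ne⟩) h5 h2.1 h1 h3⟩
      · rcases ih with ⟨_, h⟩ | ⟨b, T, S, h⟩
        · simp [hr0] at h
        · have hTa := h.rootLabel_eq hr0
          exact ⟨b, .node a' T r, S, .left a' T r S _ ((isSmirnov_left hTa).2
            ⟨h.isSmirnov_source, hr, c, hc, hca⟩) hTa h hla⟩
  | right a l r hla hl hr hra ih =>
    right
    cases r with
    | nil => exact absurd rfl hr.1
    | node e l' r' =>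
      by_cases hr0 : r' = .nil
      · subst hr0
        obtain ⟨h4, h5⟩ := isSmirnov_leaf.1 hr
        by_cases hea : e = a
        · subst hea
          obtain ⟨c, hc, hca⟩ := hra rfl
          have hl' : IsSmirnov l := ⟨ne_nil_of_rootLabel hc, hl⟩
          obtain ⟨T, S, h1, h2, h3, rfl⟩ := hl'.exists_sepHigh hc hca
          exact ⟨e, .node e l' T, S, .equalHigh l' T S ((isSmirnov_right h2.1 h5).2
            ⟨h4, h2, fun h => absurd h h3.rootLabel_ne⟩) h5 h2.1 h1 h3⟩
        -- This also holds when β has no left child, which corresponds to the step `D`.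
        · by_cases hside : ∀ c, rootLabel l' = some c → SameSide a e c
          · obtain ⟨S, hS, rfl⟩ := Step.exists_ne_U h4
            exact ⟨e, .node a l .nil, S, .base a l S (isSmirnov_leaf.2 ⟨hl, hla⟩) hS (Ne.symm hea)
              hside⟩
          · push Not at hside
            obtain ⟨c, hc, hside⟩ := hside
            have hl' : IsSmirnov l' := ⟨ne_nil_of_rootLabel hc, h4⟩
            have hce : c ≠ e := by rintro rfl; exact h5 hc
            rcases lt_or_gt_of_ne hce with h | h
            · have hae : e < a := by simp only [SameSide] at hside; omega
              obtain ⟨T, S, h1, h2, h3, rfl⟩ := hl'.exists_sepLow hc h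
              refine ⟨e, .node a l T, S, .mid a l T S ((isSmirnov_right h2.1 hla).2
                ⟨hl, h2, fun h => ?_⟩) hla h2.1 h1 (.inl ⟨hae, h3⟩)⟩
              exact absurd (h3.lt h) hae.not_gt
            · have hae : a < e := by simp only [SameSide] at hside; omega
              obtain ⟨T, S, h1, h2, h3, rfl⟩ := hl'.exists_sepHigh hc h
              refine ⟨e, .node a l T, S, .mid a l T S ((isSmirnov_right h2.1 hla).2
                ⟨hl, h2, fun h => ?_⟩) hla h2.1 h1 (.inr ⟨hae, h3⟩)⟩
              exact absurd (h3.lt h) hae.not_gt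
      · rcases ih with ⟨_, h⟩ | ⟨b, T, S, h⟩
        · simp [hr0] at h
        · have hTa := h.rootLabel_eq hr0
          exact ⟨b, .node a l T, S, .right a l T S _ ((isSmirnov_right h.isSmirnov_source.1 hla).2
            ⟨hl, h.isSmirnov_source, by rwa [hTa]⟩) hla h.isSmirnov_source.1 h hTa.symm⟩

/-! ## The map `Φ` and its graph -/

section ReplaceAtLast

variable {p : ℕ → Prop} [DecidablePred p]
  {op : ℕ → BinaryTree ℕ → BinaryTree ℕ → BinaryTree ℕ} {d : ℕ} {l r : BinaryTree ℕ}

theorem replaceAtLast_left (hr : r ≠ .nil) (hl : rootLabel l = some d)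
    (h : ∃ y ∈ principalPath l, p y) :
    replaceAtLast p op (.node d l r) = .node d (replaceAtLast p op l) r := by
  rw [replaceAtLast, principalPath_left hr hl, List.tail_cons, if_pos h, if_pos hl]

theorem replaceAtLast_right (hr : r ≠ .nil) (hl : rootLabel l ≠ some d)
    (h : ∃ y ∈ principalPath r, p y) :
    replaceAtLast p op (.node d l r) = .node d l (replaceAtLast p op r) := by
  rw [replaceAtLast, principalPath_right hr hl, List.tail_cons, if_pos h, if_neg hl]

theorem replaceAtLast_self (hr : r ≠ .nil) (hl : rootLabel l ≠ some d)
    (h : ∀ y ∈ principalPath r, ¬ p y) (hd : p d) :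
    replaceAtLast p op (.node d l r) = op d l r := by
  rw [replaceAtLast, principalPath_right hr hl, List.tail_cons,
    if_neg (by rintro ⟨y, hy, hpy⟩; exact h y hy hpy), if_pos hd]

end ReplaceAtLast

section Phi

variable {a b : ℕ} {l r T X : BinaryTree ℕ} {S : Step}

theorem phiUp_left (hr : r ≠ .nil) (hl : rootLabel l = some a)
    (h : rootLabel (phiUp l X b) = some a) :
    phiUp (.node a l r) X b = .node a (phiUp l X b) r := by
  have ha := mem_principalPath_of_rootLabel hl
  simp only [phiUp, principalLabel_left hr hl, principalPath_left hr hl, List.forall_mem_cons]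
    at h ⊢
  -- Rule 2 cannot apply to the subtree: the new root would be labeled b, forcing b = a, while a
  -- lies on that path and so strictly on one side of b.
  split_ifs at h ⊢ with h1 h2 h3 h4 h5 h6 h7 <;>
    first
    | (rw [replaceAtLast_left hr hl (by push Not at *; assumption)])
    | (simp only [rootLabel, Option.some.injEq] at h; subst h; exact absurd (by tauto) (lt_irrefl b))
    | tauto

theorem phiUp_right (hr : r ≠ .nil) (hl : rootLabel l ≠ some a)
    (h : rootLabel (phiUp r X b) = rootLabel r) :
    phiUp (.node a l r) X b = .node a l (phiUp r X b) := by
  obtain ⟨c, hc⟩ := Option.ne_none_iff_exists'.1 (mt rootLabel_eq_none.1 hr)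
  have ha := mem_principalPath_of_rootLabel hc
  rw [hc] at h
  simp only [phiUp, principalLabel_right hr hl, principalPath_right hr hl, List.forall_mem_cons]
    at h ⊢
  split_ifs at h ⊢ with h1 h2 h3 h4 h5 h6 h7 <;>
    first
    | (rw [replaceAtLast_right hr hl (by push Not at *; assumption)])
    | (simp only [rootLabel, Option.some.injEq] at h; subst h; exact absurd (by tauto) (lt_irrefl b))
    | tauto

theorem phi_left (hr : r ≠ .nil) (hl : rootLabel l = some a)
    (h : rootLabel (phi l S b) = some a) :
    phi (.node a l r) S b = .node a (phi l S b) r := by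
  cases S with
  | D => exact attach_left hr hl _
  | U => exact phiUp_left hr hl h
  | tree S =>
    simp only [phi, principalLabel_left hr hl] at h ⊢
    split_ifs at h ⊢
    · exact attach_left hr hl _
    · exact phiUp_left hr hl h

theorem phi_right (hr : r ≠ .nil) (hl : rootLabel l ≠ some a)
    (h : rootLabel (phi r S b) = rootLabel r) :
    phi (.node a l r) S b = .node a l (phi r S b) := by
  cases S with
  | D => exact attach_right hr hl _
  | U => exact phiUp_right hr hl h
  | tree S =>
    simp only [phi, principalLabel_right hr hl] at h ⊢
    split_ifs at h ⊢
    · exact attach_right hr hl _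
    · exact phiUp_right hr hl h

theorem phi_eq_attach (hS : S ≠ .U)
    (h : ∀ c, rootLabel S.subtree = some c → SameSide (principalLabel T) b c) :
    phi T S b = attach T (.node b S.subtree .nil) := by
  cases S with
  | D => rfl
  | U => exact absurd rfl hS
  | tree S =>
    obtain ⟨c, hc⟩ := Option.ne_none_iff_exists'.1 (mt rootLabel_eq_none.1 S.2.1)
    have := h c hc
    simp only [phi, hc, Option.getD_some]
    exact if_pos this

theorem phi_eq_phiUp (hS : S ≠ .D)
    (h : ∀ c, rootLabel S.subtree = some c → ¬ SameSide (principalLabel T) b c) :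
    phi T S b = phiUp T S.subtree b := by
  cases S with
  | D => exact absurd rfl hS
  | U => rfl
  | tree S =>
    obtain ⟨c, hc⟩ := Option.ne_none_iff_exists'.1 (mt rootLabel_eq_none.1 S.2.1)
    have := h c hc
    simp only [phi, hc, Option.getD_some]
    exact if_neg this

theorem phi_eq_phiUp_of_lt (hS : S ≠ .D) (ha : principalLabel T < b)
    (h : ∀ c, rootLabel S.subtree = some c → b ≤ c) : phi T S b = phiUp T S.subtree b :=
  phi_eq_phiUp hS fun c hc => by
    have := h c hc
    simp only [SameSide]
    omega

theorem phi_eq_phiUp_of_gt (hS : S ≠ .D) (ha : b < principalLabel T)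
    (h : ∀ c, rootLabel S.subtree = some c → c ≤ b) : phi T S b = phiUp T S.subtree b :=
  phi_eq_phiUp hS fun c hc => by
    have := h c hc
    simp only [SameSide]
    omega

end Phi

/-! ### Agreement of the relation with Φ -/

namespace Inserts

variable {b : ℕ} {S R : Step} {T T' U V : BinaryTree ℕ}

theorem phi_eq (h : Inserts b T S T') : phi T S b = T' := by
  induction h with
  | base a l S hT hS hab hc =>
    rw [phi_eq_attach hS (by simpa using hc), attach_leaf]
  | root T S hT hS hsep =>
    have hmem := principalLabel_mem hT.1
    rcases hsep with h | h
    · rw [phi_eq_phiUp_of_lt hS (h.1 _ hmem) h.2, phiUp, if_pos (h.1 _ hmem), if_pos h.1]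
    · rw [phi_eq_phiUp_of_gt hS (h.1 _ hmem) h.2, phiUp, if_neg (h.1 _ hmem).not_gt, if_pos h.1]
  | mid d l r S hT hl hr hS hsep =>
    have hmem := principalLabel_mem hr
    rcases hsep with ⟨hd, h⟩ | ⟨hd, h⟩
    · rw [phi_eq_phiUp_of_lt hS (by rw [principalLabel_right hr hl]; exact h.1 _ hmem) h.2, phiUp,
        principalLabel_right hr hl, principalPath_right hr hl, if_pos (h.1 _ hmem),
        if_neg (by simp [hd.le]),
        replaceAtLast_self hr hl (fun y hy => not_le.2 (h.1 y hy)) hd.le, if_neg hd.ne']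
    · rw [phi_eq_phiUp_of_gt hS (by rw [principalLabel_right hr hl]; exact h.1 _ hmem) h.2, phiUp,
        principalLabel_right hr hl, principalPath_right hr hl, if_neg (h.1 _ hmem).not_gt,
        if_neg (by simp [hd.le]),
        replaceAtLast_self hr hl (fun y hy => not_le.2 (h.1 y hy)) hd.le, if_neg hd.ne]
  | equalLow l r S hT hl hr hS h =>
    have hmem := principalLabel_mem hr
    rw [phi_eq_phiUp_of_lt hS (by rw [principalLabel_right hr hl]; exact h.1 _ hmem) h.2, phiUp,
      principalLabel_right hr hl, principalPath_right hr hl, if_pos (h.1 _ hmem),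
      if_neg (by simp), replaceAtLast_self hr hl (fun y hy => not_le.2 (h.1 y hy)) le_rfl,
      if_pos rfl]
  | equalHigh l r S hT hl hr hS h =>
    have hmem := principalLabel_mem hr
    rw [phi_eq_phiUp_of_gt hS (by rw [principalLabel_right hr hl]; exact h.1 _ hmem) h.2, phiUp,
      principalLabel_right hr hl, principalPath_right hr hl, if_neg (h.1 _ hmem).not_gt,
      if_neg (by simp), replaceAtLast_self hr hl (fun y hy => not_le.2 (h.1 y hy)) le_rfl,
      if_pos rfl]
  | left a l r S l' hT hl _ hl' ih =>
    subst ih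
    exact phi_left (ne_nil_of_isSmirnov_left hl hT) hl hl'
  | right a l r S r' hT hl hr h hr' ih =>
    subst ih
    exact phi_right hr hl hr'

theorem exists_base (hT : IsSmirnov T) (hS : S ≠ .U) (hb : principalLabel T ≠ b)
    (h : ∀ c, rootLabel S.subtree = some c → SameSide (principalLabel T) b c) :
    ∃ T', Inserts b T S T' ∧ rootLabel T' = rootLabel T := by
  induction T, hT using IsSmirnov.pathInduction with
  | leaf a l hl hla =>
    rw [principalLabel_leaf] at hb h
    exact ⟨_, .base a l S (isSmirnov_leaf.2 ⟨hl, hla⟩) hS hb h, rfl⟩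
  | left a l r hla hl hr hra ih =>
    have hT := (isSmirnov_left hla).2 ⟨hl, hr, hra⟩
    rw [principalLabel_left (ne_nil_of_isSmirnov_left hla hT) hla] at hb h
    obtain ⟨l', h1, h2⟩ := ih hb h
    exact ⟨_, .left a l r S l' hT hla h1 (h2.trans hla), rfl⟩
  | right a l r hla hl hr hra ih =>
    have hT := (isSmirnov_right hr.1 hla).2 ⟨hl, hr, hra⟩
    rw [principalLabel_right hr.1 hla] at hb h
    obtain ⟨r', h1, h2⟩ := ih hb h
    exact ⟨_, .right a l r S r' hT hla hr.1 h1 h2, rfl⟩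

/-- The second alternative tells the parent that the subtree contains no candidate for δ. The parent
then discards the inserted subtree and compares its own label with b. A vertex where the path turns
left is never δ, since the next vertex has the same label. -/
theorem exists_of_lt (hT : IsSmirnov T) (hS : S ≠ .D) (hb : principalLabel T < b)
    (h : ∀ c, rootLabel S.subtree = some c → b ≤ c) :
    ∃ T', Inserts b T S T' ∧
      (rootLabel T' = rootLabel T ∨ ∀ y ∈ principalPath T, y < b) := by
  induction T, hT using IsSmirnov.pathInduction with
  | leaf a l hl hla =>
    rw [principalLabel_leaf] at hb
    have hsep : ∀ y ∈ principalPath (.node a l .nil), y < b := by simpa using hb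
    exact ⟨_, .root _ S (isSmirnov_leaf.2 ⟨hl, hla⟩) hS (.inl ⟨hsep, h⟩), .inr hsep⟩
  | left a l r hla hl hr hra ih =>
    have hT := (isSmirnov_left hla).2 ⟨hl, hr, hra⟩
    have hr0 := ne_nil_of_isSmirnov_left hla hT
    rw [principalLabel_left hr0 hla] at hb
    obtain ⟨l', h1, h2 | h2⟩ := ih hb
    · exact ⟨_, .left a l r S l' hT hla h1 (h2.trans hla), .inl rfl⟩
    · have hsep : ∀ y ∈ principalPath (.node a l r), y < b := by
        rw [principalPath_left hr0 hla]
        exact List.forall_mem_cons.2 ⟨h2 a (mem_principalPath_of_rootLabel hla), h2⟩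
      exact ⟨_, .root _ S hT hS (.inl ⟨hsep, h⟩), .inr hsep⟩
  | right a l r hla hl hr hra ih =>
    have hT := (isSmirnov_right hr.1 hla).2 ⟨hl, hr, hra⟩
    rw [principalLabel_right hr.1 hla] at hb
    obtain ⟨r', h1, h2 | h2⟩ := ih hb
    · exact ⟨_, .right a l r S r' hT hla hr.1 h1 h2, .inl rfl⟩
    · rcases lt_trichotomy a b with hab | rfl | hab
      · have hsep : ∀ y ∈ principalPath (.node a l r), y < b := by
          rw [principalPath_right hr.1 hla]
          exact List.forall_mem_cons.2 ⟨hab, h2⟩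
        exact ⟨_, .root _ S hT hS (.inl ⟨hsep, h⟩), .inr hsep⟩
      · exact ⟨_, .equalLow l r S hT hla hr.1 hS ⟨h2, h⟩, .inl rfl⟩
      · exact ⟨_, .mid a l r S hT hla hr.1 hS (.inl ⟨hab, h2, h⟩), .inl rfl⟩

theorem exists_of_gt (hT : IsSmirnov T) (hS : S ≠ .D) (hb : b < principalLabel T)
    (h : ∀ c, rootLabel S.subtree = some c → c ≤ b) :
    ∃ T', Inserts b T S T' ∧
      (rootLabel T' = rootLabel T ∨ ∀ y ∈ principalPath T, b < y) := by
  induction T, hT using IsSmirnov.pathInduction with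
  | leaf a l hl hla =>
    rw [principalLabel_leaf] at hb
    have hsep : ∀ y ∈ principalPath (.node a l .nil), b < y := by simpa using hb
    exact ⟨_, .root _ S (isSmirnov_leaf.2 ⟨hl, hla⟩) hS (.inr ⟨hsep, h⟩), .inr hsep⟩
  | left a l r hla hl hr hra ih =>
    have hT := (isSmirnov_left hla).2 ⟨hl, hr, hra⟩
    have hr0 := ne_nil_of_isSmirnov_left hla hT
    rw [principalLabel_left hr0 hla] at hb
    obtain ⟨l', h1, h2 | h2⟩ := ih hb
    · exact ⟨_, .left a l r S l' hT hla h1 (h2.trans hla), .inl rfl⟩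
    · have hsep : ∀ y ∈ principalPath (.node a l r), b < y := by
        rw [principalPath_left hr0 hla]
        exact List.forall_mem_cons.2 ⟨h2 a (mem_principalPath_of_rootLabel hla), h2⟩
      exact ⟨_, .root _ S hT hS (.inr ⟨hsep, h⟩), .inr hsep⟩
  | right a l r hla hl hr hra ih =>
    have hT := (isSmirnov_right hr.1 hla).2 ⟨hl, hr, hra⟩
    rw [principalLabel_right hr.1 hla] at hb
    obtain ⟨r', h1, h2 | h2⟩ := ih hb
    · exact ⟨_, .right a l r S r' hT hla hr.1 h1 h2, .inl rfl⟩
    · rcases lt_trichotomy a b with hab | rfl | hab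
      · exact ⟨_, .mid a l r S hT hla hr.1 hS (.inr ⟨hab, h2, h⟩), .inl rfl⟩
      · exact ⟨_, .equalHigh l r S hT hla hr.1 hS ⟨h2, h⟩, .inl rfl⟩
      · have hsep : ∀ y ∈ principalPath (.node a l r), b < y := by
          rw [principalPath_right hr.1 hla]
          exact List.forall_mem_cons.2 ⟨hab, h2⟩
        exact ⟨_, .root _ S hT hS (.inr ⟨hsep, h⟩), .inr hsep⟩

/-- By `phi_eq` any related tree is the value of Φ, so existence suffices. Rule 1 is `exists_base`;
otherwise a tree S has its root weakly on the other side of b from a. -/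
theorem _root_.Smirnov.IsSmirnov.inserts_phi (hT : IsSmirnov T) (S : Step)
    (hb : principalLabel T ≠ b) : Inserts b T S (phi T S b) := by
  suffices ∃ T', Inserts b T S T' by
    obtain ⟨T', h⟩ := this
    rwa [h.phi_eq]
  by_cases hbase : S ≠ .U ∧ ∀ c, rootLabel S.subtree = some c → SameSide (principalLabel T) b c
  · obtain ⟨T', h, -⟩ := exists_base hT hbase.1 hb hbase.2
    exact ⟨T', h⟩
  · have hS : S ≠ .D := by
      rintro rfl
      simp [Step.subtree, rootLabel] at hbase
    have hside : ∀ c, rootLabel S.subtree = some c → ¬ SameSide (principalLabel T) b c := by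
      intro c hc hside
      refine hbase ⟨?_, fun c' hc' => ?_⟩
      · rintro rfl
        simp [Step.subtree, rootLabel] at hc
      · obtain rfl : c = c' := by simpa [hc] using hc'
        exact hside
    rcases lt_or_gt_of_ne hb with hb | hb
    · obtain ⟨T', h, -⟩ := exists_of_lt hT hS hb fun c hc => by
        have := hside c hc
        simp only [SameSide] at this
        omega
      exact ⟨T', h⟩
    · obtain ⟨T', h, -⟩ := exists_of_gt hT hS hb fun c hc => by
        have := hside c hc
        simp only [SameSide] at this
        omega
      exact ⟨T', h⟩

end Inserts

/-! ### Injectivity of insertion -/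

namespace Inserts

variable {b : ℕ} {S R : Step} {T T' U V : BinaryTree ℕ}

theorem principalLabel_ne (h : Inserts b T S T') : principalLabel T ≠ b := by
  induction h with
  | base a l S hT hS hab hc => rwa [principalLabel_leaf]
  | root T S hT hS hsep =>
    have hmem := principalLabel_mem hT.1
    exact hsep.elim (fun h => (h.1 _ hmem).ne) fun h => (h.1 _ hmem).ne'
  | mid d l r S hT hl hr hS hsep =>
    have hmem := principalLabel_mem hr
    rw [principalLabel_right hr hl]
    exact hsep.elim (fun h => (h.2.1 _ hmem).ne) fun h => (h.2.1 _ hmem).ne'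
  | equalLow l r S hT hl hr hS h =>
    rw [principalLabel_right hr hl]
    exact (h.1 _ (principalLabel_mem hr)).ne
  | equalHigh l r S hT hl hr hS h =>
    rw [principalLabel_right hr hl]
    exact (h.1 _ (principalLabel_mem hr)).ne'
  | left a l r S l' hT hl _ hl' ih => rwa [principalLabel_left (ne_nil_of_isSmirnov_left hl hT) hl]
  | right a l r S r' hT hl hr _ hr' ih => rwa [principalLabel_right hr hl]

theorem left_ne {a : ℕ} {l l' l'' : BinaryTree ℕ} (h : Inserts b l S l')
    (hl : rootLabel l = some a) (h' : l' = .node a l'' .nil) : False := by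
  subst h'
  exact h.right_ne_nil hl rfl

theorem right_ne {r r' l'' : BinaryTree ℕ} {a : ℕ} (h : Inserts b r S r')
    (hr : rootLabel r' = rootLabel r) (h' : r' = .node a l'' .nil) : False := by
  subst h'
  exact h.right_ne_nil hr.symm rfl

/-- The shape of the result around β determines the constructor: rules 1 and 3 differ in the sides
of the labels around β, and placing β as a child differs from recursing because β has no right child
whereas a preserved root has one. Within a constructor, unique cutting recovers T and S. -/
theorem inj (h : Inserts b T S V) (h' : Inserts b U R V) : T = U ∧ S = R := by
  generalize hV : V = V' at h'
  induction h generalizing U V' with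
  | base a l S hT hS hab hside =>
    have hla := (isSmirnov_leaf.1 hT).2
    cases h' with
    | base a' l' _ hT' hS' hab' hside' =>
      simp only [BinaryTree.node.injEq] at hV
      obtain ⟨rfl, rfl, -, h, -⟩ := hV
      exact ⟨rfl, Step.eq_of_ne_U hS hS' h⟩
    | mid d' l' r' _ hT' hl' hr' hS' hsep' =>
      exfalso
      simp only [BinaryTree.node.injEq] at hV
      obtain ⟨rfl, rfl, -, h, -⟩ := hV
      obtain ⟨c, hc⟩ := Option.ne_none_iff_exists'.1 (mt rootLabel_eq_none.1 hr')
      have := hside c (by rw [h, rootLabel_attach, hc])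
      rcases hsep' with ⟨h1, h2⟩ | ⟨h1, h2⟩
      · have := h2.lt hc; simp only [SameSide] at *; omega
      · have := h2.lt hc; simp only [SameSide] at *; omega
    | right a' l' r' _ r'' hT' hl' hr' h' hr'' =>
      exfalso
      simp only [BinaryTree.node.injEq] at hV
      exact h'.right_ne hr'' hV.2.2.symm
    | _ => exfalso; grind [rootLabel]
  | root T S hT hS hsep =>
    cases h' with
    | root _ _ hT' hS' hsep' =>
      simp only [BinaryTree.node.injEq, true_and, and_true] at hV
      obtain ⟨rfl, h⟩ := attach_inj_of_sep hT hT' hsep hsep' hV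
      exact ⟨rfl, Step.eq_of_ne_D hS hS' h⟩
    | right a' l' r' _ r'' hT' hl' hr' h' hr'' =>
      exfalso
      simp only [BinaryTree.node.injEq] at hV
      exact h'.isSmirnov.1 hV.2.2.symm
    | _ => exfalso; grind [attach_ne_nil, ne_nil_of_isSmirnov_left]
  | mid d l r S hT hl hr hS hsep =>
    have hsm := ((isSmirnov_right hr hl).1 hT).2.1
    cases h' with
    | base a' l' _ hT' hS' hab' hside' =>
      exfalso
      simp only [BinaryTree.node.injEq] at hV
      obtain ⟨rfl, rfl, -, h, -⟩ := hV
      obtain ⟨c, hc⟩ := Option.ne_none_iff_exists'.1 (mt rootLabel_eq_none.1 hr)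
      have := hside' c (by rw [← h, rootLabel_attach, hc])
      rcases hsep with ⟨h1, h2⟩ | ⟨h1, h2⟩
      · have := h2.lt hc; simp only [SameSide] at *; omega
      · have := h2.lt hc; simp only [SameSide] at *; omega
    | mid d' l' r' _ hT' hl' hr' hS' hsep' =>
      simp only [BinaryTree.node.injEq, true_and, and_true] at hV
      obtain ⟨rfl, rfl, h⟩ := hV
      obtain ⟨rfl, hX⟩ := attach_inj_of_sep hsm ((isSmirnov_right hr' hl').1 hT').2.1
        (hsep.imp And.right And.right) (hsep'.imp And.right And.right) h
      exact ⟨rfl, Step.eq_of_ne_D hS hS' hX⟩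
    | right a' l' r' _ r'' hT' hl' hr' h' hr'' =>
      exfalso
      simp only [BinaryTree.node.injEq] at hV
      exact h'.right_ne hr'' hV.2.2.symm
    | _ => exfalso; grind
  | equalLow l r S hT hl hr hS h =>
    have hsm := ((isSmirnov_right hr hl).1 hT).2.1
    cases h' with
    | equalLow l' r' _ hT' hl' hr' hS' hsep' =>
      simp only [BinaryTree.node.injEq, true_and, and_true] at hV
      obtain ⟨rfl, hV⟩ := hV
      obtain ⟨rfl, h⟩ := h.attach_inj hsm ((isSmirnov_right hr' hl').1 hT').2.1 hsep' hV
      exact ⟨rfl, Step.eq_of_ne_D hS hS' h⟩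
    | left a' l' r' _ l'' hT' hl' h' hl'' =>
      exfalso
      simp only [BinaryTree.node.injEq] at hV
      obtain ⟨rfl, h2, -⟩ := hV
      exact h'.left_ne hl' h2.symm
    | _ => exfalso; grind [rootLabel, attach_ne_nil, rootLabel_attach, SepHigh.rootLabel_ne]
  | equalHigh l r S hT hl hr hS h =>
    have hsm := ((isSmirnov_right hr hl).1 hT).2.1
    cases h' with
    | equalHigh l' r' _ hT' hl' hr' hS' hsep' =>
      simp only [BinaryTree.node.injEq, true_and, and_true] at hV
      obtain ⟨hV, rfl⟩ := hV
      obtain ⟨rfl, h⟩ := h.attach_inj hsm ((isSmirnov_right hr' hl').1 hT').2.1 hsep' hV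
      exact ⟨rfl, Step.eq_of_ne_D hS hS' h⟩
    | right a' l' r' _ r'' hT' hl' hr' h' hr'' =>
      exfalso
      simp only [BinaryTree.node.injEq] at hV
      exact h'.right_ne hr'' hV.2.2.symm
    | _ => exfalso; grind [rootLabel, attach_ne_nil, rootLabel_attach, SepHigh.rootLabel_ne]
  | left a l r S l' hT hl h hl' ih =>
    have hr0 := ne_nil_of_isSmirnov_left hl hT
    cases h' with
    | equalLow l₁ r₁ _ hT₁ hl₁ hr₁ hS₁ hsep₁ =>
      exfalso
      simp only [BinaryTree.node.injEq] at hV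
      obtain ⟨rfl, h2, -⟩ := hV
      exact h.left_ne hl h2
    | left a₁ l₁ r₁ _ l₁' hT₁ hl₁ h₁ hl₁' =>
      simp only [BinaryTree.node.injEq] at hV
      obtain ⟨rfl, rfl, rfl⟩ := hV
      obtain ⟨rfl, rfl⟩ := ih _ rfl h₁
      exact ⟨rfl, rfl⟩
    | base a₁ l₁ _ hT₁ hS₁ hab₁ hside₁ =>
      exfalso
      have := (isSmirnov_leaf.1 hT₁).2
      grind
    | _ => exfalso; grind [rootLabel, rootLabel_attach, SepHigh.rootLabel_ne]
  | right a l r S r' hT hl hr h hr' ih =>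
    have hr0 := h.isSmirnov.1
    cases h' with
    | right a₁ l₁ r₁ _ r₁' hT₁ hl₁ hr₁ h₁ hr₁' =>
      simp only [BinaryTree.node.injEq] at hV
      obtain ⟨rfl, rfl, rfl⟩ := hV
      obtain ⟨rfl, rfl⟩ := ih _ rfl h₁
      exact ⟨rfl, rfl⟩
    | base | mid | equalHigh =>
      exfalso
      simp only [BinaryTree.node.injEq] at hV
      exact h.right_ne hr' hV.2.2
    | _ => exfalso; grind [rootLabel]

end Inserts

/-! ## The map `Ψ` -/

theorem SmirnovWord.init {n : ℕ} {w : Fin (n + 2) → ℕ}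
    (hw : ∀ i j : Fin (n + 2), (j : ℕ) = i + 1 → w i ≠ w j) :
    (∀ i j : Fin (n + 1), (j : ℕ) = i + 1 → (Fin.init w : Fin (n + 1) → ℕ) i ≠ Fin.init w j) ∧
      w (Fin.last n).castSucc ≠ w (Fin.last (n + 1)) :=
  ⟨fun i j h => hw _ _ (by simpa using h), hw _ _ (by simp)⟩

theorem psi_spec (n : ℕ) (w : Fin (n + 1) → ℕ)
    (hw : ∀ i j : Fin (n + 1), (j : ℕ) = i + 1 → w i ≠ w j) (S : Fin n → Step) :
    IsSmirnov (psi n w S) ∧ principalLabel (psi n w S) = w (Fin.last n) := by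
  induction n with
  | zero => exact ⟨isSmirnov_leaf.2 ⟨trivial, by simp [rootLabel]⟩, by simp [psi]⟩
  | succ n ih =>
    obtain ⟨h1, h2⟩ := SmirnovWord.init hw
    obtain ⟨h3, h4⟩ := ih (Fin.init w) h1 (Fin.init S)
    have := h3.inserts_phi (S (Fin.last n)) (h4.trans_ne h2)
    exact ⟨this.isSmirnov, this.principalLabel_eq⟩

theorem inserts_psi (n : ℕ) (w : Fin (n + 2) → ℕ)
    (hw : ∀ i j : Fin (n + 2), (j : ℕ) = i + 1 → w i ≠ w j) (S : Fin (n + 1) → Step) :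
    Inserts (w (Fin.last (n + 1))) (psi n (Fin.init w) (Fin.init S)) (S (Fin.last n))
      (psi (n + 1) w S) := by
  obtain ⟨h1, h2⟩ := SmirnovWord.init hw
  obtain ⟨h3, h4⟩ := psi_spec n (Fin.init w) h1 (Fin.init S)
  exact h3.inserts_phi (S (Fin.last n)) (h4.trans_ne h2)

theorem pairWeight_succ {n : ℕ} (w : Fin (n + 2) → ℕ) (S : Fin (n + 1) → Step) :
    pairWeight w S = pairWeight (Fin.init w : Fin (n + 1) → ℕ) (Fin.init S) *
      x (w (Fin.last (n + 1))) *
      stepWeight (w (Fin.last n).castSucc) (w (Fin.last (n + 1))) (S (Fin.last n)) := by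
  rw [pairWeight, pairWeight, xWord, xWord, Fin.prod_univ_castSucc (n := n + 1),
    Fin.prod_univ_castSucc (fun i : Fin (n + 1) => stepWeight (w i.castSucc) (w i.succ) (S i))]
  simp only [Fin.init, Fin.succ_castSucc, Fin.succ_last]
  ring

theorem weight_psi (n : ℕ) (w : Fin (n + 1) → ℕ)
    (hw : ∀ i j : Fin (n + 1), (j : ℕ) = i + 1 → w i ≠ w j) (S : Fin n → Step) :
    weight (psi n w S) = pairWeight w S := by
  induction n with
  | zero => simp [psi, pairWeight, weight, xWord]
  | succ n ih =>
    obtain ⟨h1, -⟩ := SmirnovWord.init hw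
    rw [(inserts_psi n w hw S).weight_eq, (psi_spec n _ h1 _).2, ih _ h1, pairWeight_succ]
    rfl

/-- The principal label gives the last letter, after which `Inserts.inj` gives the preceding tree
and the last step. Lengths are not assumed equal, hence the comparison of dependent pairs. -/
theorem psi_inj {n m : ℕ} {w : Fin (n + 1) → ℕ} {v : Fin (m + 1) → ℕ}
    (hw : ∀ i j : Fin (n + 1), (j : ℕ) = i + 1 → w i ≠ w j)
    (hv : ∀ i j : Fin (m + 1), (j : ℕ) = i + 1 → v i ≠ v j) {S : Fin n → Step}
    {R : Fin m → Step} (h : psi n w S = psi m v R) :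
    (⟨n, w, S⟩ : Σ n : ℕ, (Fin (n + 1) → ℕ) × (Fin n → Step)) = ⟨m, v, R⟩ := by
  induction n generalizing m with
  | zero =>
    cases m with
    | zero =>
      obtain rfl : S = R := Subsingleton.elim _ _
      obtain rfl : w = v := by
        funext i
        rw [Fin.fin_one_eq_zero i]
        simpa [psi] using h
      rfl
    | succ m =>
      -- A one-node tree is not the result of an insertion, which has more nodes than a nonempty
      -- tree.
      have h' := (inserts_psi m v hv R).numNodes_lt
      have h'' := (psi_spec m _ (SmirnovWord.init hv).1 (Fin.init R)).1.1
      rw [← h] at h'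
      simp only [psi, BinaryTree.numNodes] at h'
      cases hT : psi m (Fin.init v) (Fin.init R) with
      | nil => exact absurd hT h''
      | node => simp [hT, BinaryTree.numNodes] at h'
  | succ n ih =>
    cases m with
    | zero =>
      have h' := (inserts_psi n w hw S).numNodes_lt
      have h'' := (psi_spec n _ (SmirnovWord.init hw).1 (Fin.init S)).1.1
      rw [h] at h'
      simp only [psi, BinaryTree.numNodes] at h'
      cases hT : psi n (Fin.init w) (Fin.init S) with
      | nil => exact absurd hT h''
      | node => simp [hT, BinaryTree.numNodes] at h'
    | succ m =>
      have h1 := inserts_psi n w hw S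
      have h2 := inserts_psi m v hv R
      rw [← h] at h2
      have hb : w (Fin.last (n + 1)) = v (Fin.last (m + 1)) :=
        h1.principalLabel_eq.symm.trans h2.principalLabel_eq
      rw [← hb] at h2
      obtain ⟨h3, h4⟩ := h1.inj h2
      have h5 := ih (SmirnovWord.init hw).1 (SmirnovWord.init hv).1 h3
      obtain rfl : n = m := congrArg Sigma.fst h5
      simp only [Sigma.mk.injEq, heq_eq_eq, Prod.mk.injEq, true_and] at h5
      obtain rfl : w = v := by
        rw [← Fin.snoc_init_self w, ← Fin.snoc_init_self v, h5.1, hb]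
      obtain rfl : S = R := by
        rw [← Fin.snoc_init_self S, ← Fin.snoc_init_self R, h5.2, h4]
      rfl

theorem exists_psi_eq {T : BinaryTree ℕ} (hT : IsSmirnov T) :
    ∃ (n : ℕ) (w : Fin (n + 1) → ℕ) (S : Fin n → Step),
      (∀ i j : Fin (n + 1), (j : ℕ) = i + 1 → w i ≠ w j) ∧ psi n w S = T := by
  induction hk : T.numNodes using Nat.strong_induction_on generalizing T with
  | _ k ih =>
    rcases hT.exists_inserts with ⟨a, rfl⟩ | ⟨b, U, s, h⟩
    · refine ⟨0, fun _ => a, Fin.elim0, fun i j h => ?_, rfl⟩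
      omega
    · obtain ⟨n, w, S, hw, rfl⟩ := ih _ (hk ▸ h.numNodes_lt) h.isSmirnov_source rfl
      refine ⟨n + 1, Fin.snoc w b, Fin.snoc S s, fun i j hij => ?_, ?_⟩
      · induction j using Fin.lastCases with
        | last =>
          obtain rfl : i = (Fin.last n).castSucc := by
            ext
            simpa using hij.symm
          rw [Fin.snoc_castSucc, Fin.snoc_last, ← (psi_spec n w hw S).2]
          exact h.principalLabel_ne
        | cast j =>
          have hi : (i : ℕ) < n + 1 := by
            have := j.2
            simp only [Fin.val_castSucc] at hij
            omega
          obtain ⟨i, rfl⟩ : ∃ i' : Fin (n + 1), i = i'.castSucc := ⟨⟨i, hi⟩, rfl⟩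
          rw [Fin.snoc_castSucc, Fin.snoc_castSucc]
          exact hw i j (by simpa using hij)
      · rw [psi, Fin.init_snoc, Fin.init_snoc, Fin.snoc_last, Fin.snoc_last, h.phi_eq]

/-! ## Summability -/

/-- The number of vertices of each label. -/
noncomputable def content : BinaryTree ℕ → (ℕ →₀ ℕ)
  | .nil => 0
  | .node a l r => Finsupp.single a 1 + content l + content r

theorem exists_leftEdgeWeight_eq_C (a : ℕ) (l : BinaryTree ℕ) :
    ∃ k : CoeffRing, leftEdgeWeight a l = MvPowerSeries.C k := by
  unfold leftEdgeWeight
  split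
  · exact ⟨1, (map_one _).symm⟩
  · split_ifs
    · exact ⟨_, rfl⟩
    · exact ⟨_, rfl⟩

theorem exists_rightEdgeWeight_eq_C (a : ℕ) (r : BinaryTree ℕ) :
    ∃ k : CoeffRing, rightEdgeWeight a r = MvPowerSeries.C k := by
  unfold rightEdgeWeight
  split
  · exact ⟨1, (map_one _).symm⟩
  · split_ifs
    · exact ⟨_, rfl⟩
    · exact ⟨_, rfl⟩

theorem exists_weight_eq_monomial (T : BinaryTree ℕ) :
    ∃ k : CoeffRing, weight T = MvPowerSeries.monomial (content T) k := by
  induction T with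
  | nil => exact ⟨1, rfl⟩
  | node a l r ihl ihr =>
    obtain ⟨k₁, h₁⟩ := exists_leftEdgeWeight_eq_C a l
    obtain ⟨k₂, h₂⟩ := exists_rightEdgeWeight_eq_C a r
    obtain ⟨k₃, h₃⟩ := ihl
    obtain ⟨k₄, h₄⟩ := ihr
    refine ⟨1 * k₁ * k₂ * k₃ * k₄, ?_⟩
    rw [weight, h₁, h₂, h₃, h₄, x, MvPowerSeries.X, ← MvPowerSeries.monomial_zero_eq_C_apply,
      ← MvPowerSeries.monomial_zero_eq_C_apply]
    simp only [MvPowerSeries.monomial_mul_monomial, content, add_zero]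

/-- The root label lies in the support of `d`, and each subtree has smaller degree, leaving finitely
many choices by induction. -/
theorem finite_setOf_content_le (d : ℕ →₀ ℕ) (k : ℕ) :
    {T : BinaryTree ℕ | content T ≤ d ∧ (content T).degree ≤ k}.Finite := by
  induction k with
  | zero =>
    refine (Set.finite_singleton (BinaryTree.nil : BinaryTree ℕ)).subset ?_
    rintro (_ | ⟨a, l, r⟩) ⟨-, h⟩
    · rfl
    · simp [content] at h
  | succ k ih =>
    refine (((d.support.finite_toSet.prod (ih.prod ih)).image
      fun q => BinaryTree.node q.1 q.2.1 q.2.2).insert .nil).subset ?_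
    rintro (_ | ⟨a, l, r⟩) ⟨h₁, h₂⟩
    · exact Set.mem_insert _ _
    · simp only [content, map_add, Finsupp.degree_single] at h₁ h₂
      refine Set.mem_insert_of_mem _ ⟨(a, l, r), ⟨?_, ⟨?_, ?_⟩, ?_, ?_⟩, rfl⟩
      · have := h₁ a
        simp only [Finsupp.add_apply, Finsupp.single_eq_same] at this
        simp only [Finset.mem_coe, Finsupp.mem_support_iff]
        omega
      · exact (le_add_self.trans le_self_add).trans h₁
      · change (content l).degree ≤ k
        omega
      · exact le_add_self.trans h₁
      · change (content r).degree ≤ k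
        omega

/-- Coefficients are discrete, so a family of them is summable only if it has finite support. -/
theorem summable_series_iff {ι : Type*} {f : ι → Series} :
    Summable f ↔ ∀ d : ℕ →₀ ℕ, {i | MvPowerSeries.coeff d (f i) ≠ 0}.Finite := by
  rw [MvPowerSeries.WithPiTopology.summable_iff_summable_coeff]
  exact forall_congr' fun d => ⟨fun h => h.hasFiniteSupport_of_discreteTopology,
    fun h => summable_of_hasFiniteSupport h⟩

theorem summable_weight : Summable fun T : SmirnovTree => weight T.1 := by
  refine summable_series_iff.2 fun d => ?_
  refine Set.Finite.subset ((finite_setOf_content_le d d.degree).preimage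
    (f := fun T : SmirnovTree => T.1) Subtype.val_injective.injOn) fun T hT => ?_
  obtain ⟨k, hk⟩ := exists_weight_eq_monomial T.1
  classical
  simp only [Set.mem_ofPred_eq, hk, MvPowerSeries.coeff_monomial, ne_eq, ite_eq_right_iff,
    Classical.not_imp] at hT
  obtain ⟨rfl, -⟩ := hT
  exact ⟨le_rfl, le_rfl⟩

/-! ### Sums over independent choices of steps -/

theorem summable_mul_series {ι κ : Type*} {f : ι → Series} {g : κ → Series} (hf : Summable f)
    (hg : Summable g) : Summable fun p : ι × κ => f p.1 * g p.2 := by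
  classical
  rw [summable_series_iff] at *
  intro d
  refine ((Finset.HasAntidiagonal.antidiagonal d).finite_toSet.biUnion
    fun e _ => (hf e.1).prod (hg e.2)).subset fun p hp => ?_
  rw [Set.mem_ofPred_eq, MvPowerSeries.coeff_mul] at hp
  obtain ⟨e, he, hne⟩ := Finset.exists_ne_zero_of_sum_ne_zero hp
  exact Set.mem_biUnion he ⟨left_ne_zero_of_mul hne, right_ne_zero_of_mul hne⟩

theorem hasSum_mul_series {ι κ : Type*} {f : ι → Series} {g : κ → Series} {u v : Series}
    (hf : HasSum f u) (hg : HasSum g v) : HasSum (fun p : ι × κ => f p.1 * g p.2) (u * v) := by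
  have h := summable_mul_series hf.summable hg.summable
  exact hf.mul hg h

theorem hasSum_prod_series {κ : Type*} {n : ℕ} {f : Fin n → κ → Series} {g : Fin n → Series}
    (h : ∀ i, HasSum (f i) (g i)) : HasSum (fun S : Fin n → κ => ∏ i, f i (S i)) (∏ i, g i) := by
  induction n with
  | zero =>
    simp only [Finset.univ_eq_empty, Finset.prod_empty]
    exact hasSum_unique _
  | succ n ih =>
    rw [← (Fin.consEquiv fun _ => κ).hasSum_iff, Fin.prod_univ_succ]
    have h' : HasSum (fun S : Fin n → κ => ∏ i, f i.succ (S i)) (∏ i : Fin n, g i.succ) :=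
      ih fun i => h i.succ
    have h'' := hasSum_mul_series (h 0) h'
    simpa only [Function.comp_def, Fin.consEquiv, Equiv.coe_fn_mk, Fin.prod_univ_succ,
      Fin.cons_zero, Fin.cons_succ] using h''

/-- A step is a Smirnov tree or one of the two symbols `D`, `U`. -/
def stepEquiv : SmirnovTree ⊕ Bool ≃ Step where
  toFun := Sum.elim .tree fun e => if e then .D else .U
  invFun
    | .D => .inr true
    | .U => .inr false
    | .tree S => .inl S
  left_inv := by rintro (S | _ | _) <;> rfl
  right_inv := by rintro (_ | _ | S) <;> rfl

theorem hasSum_stepWeight (a b : ℕ) : HasSum (stepWeight a b) (if a < b then s else t) := by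
  have hG : HasSum (fun T : SmirnovTree => weight T.1) G := summable_weight.hasSum
  rw [← stepEquiv.hasSum_iff]
  by_cases hab : a < b
  · have h : s = edge .lamBar * edge .rhoBar * G + (edge .rhoBar + edge .lamBar) := by
      rw [s]; ring
    rw [if_pos hab, h]
    refine HasSum.sum ?_ ?_
    · simpa [Function.comp_def, stepEquiv, stepWeight, hab] using
        hG.mul_left (edge .lamBar * edge .rhoBar)
    · simpa [Function.comp_def, stepEquiv, stepWeight, hab] using
        hasSum_fintype ((stepWeight a b ∘ stepEquiv) ∘ Sum.inr)
  · have h : t = edge .lam * edge .rho * G + (edge .rho + edge .lam) := by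
      rw [t]; ring
    rw [if_neg hab, h]
    refine HasSum.sum ?_ ?_
    · simpa [Function.comp_def, stepEquiv, stepWeight, hab] using
        hG.mul_left (edge .lam * edge .rho)
    · simpa [Function.comp_def, stepEquiv, stepWeight, hab] using
        hasSum_fintype ((stepWeight a b ∘ stepEquiv) ∘ Sum.inr)

theorem prod_ite_eq_pow (n : ℕ) (w : SmirnovWord (n + 1)) :
    ∏ i : Fin n, (if w.1 i.castSucc < w.1 i.succ then s else t) =
      s ^ asc w.1 * t ^ des w.1 := by
  rw [Finset.prod_ite, Finset.prod_const, Finset.prod_const, asc, des]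
  congr 3
  ext i
  -- Adjacent letters differ, so every position that is not an ascent is a descent.
  have := w.2 i.castSucc i.succ (by simp)
  simp only [Finset.mem_filter, Finset.mem_univ, true_and]
  omega

theorem hasSum_pairWeight (n : ℕ) (w : SmirnovWord (n + 1)) :
    HasSum (fun S : Fin n → Step => pairWeight w.1 S)
      (s ^ asc w.1 * t ^ des w.1 * xWord w.1) := by
  rw [← prod_ite_eq_pow, mul_comm]
  exact (hasSum_prod_series fun i => hasSum_stepWeight _ _).mul_left _

/-! ### The bijection and the functional equation -/

theorem bijOn_psi : Set.BijOn
    (fun p : Σ n : ℕ, SmirnovWord (n + 1) × (Fin n → Step) => psi p.1 p.2.1.1 p.2.2)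
    Set.univ {T | IsSmirnov T} := by
  refine ⟨fun p _ => (psi_spec _ _ p.2.1.2 _).1, ?_, ?_⟩
  · rintro ⟨n, ⟨w, hw⟩, S⟩ - ⟨m, ⟨v, hv⟩, R⟩ - h
    have h' := psi_inj hw hv h
    obtain rfl : n = m := congrArg Sigma.fst h'
    simp only [Sigma.mk.injEq, heq_eq_eq, Prod.mk.injEq, true_and] at h'
    obtain ⟨rfl, rfl⟩ := h'
    rfl
  · intro T hT
    obtain ⟨n, w, S, hw, h⟩ := exists_psi_eq hT
    exact ⟨⟨n, ⟨w, hw⟩, S⟩, Set.mem_univ _, h⟩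

theorem hasSum_smirnovWord : HasSum
    (fun p : Σ n : ℕ, SmirnovWord (n + 1) => s ^ asc p.2.1 * t ^ des p.2.1 * xWord p.2.1) G := by
  -- The pairs are regrouped with the word as base and the steps as fibre, so that the sum over
  -- trees can be taken fibrewise.
  let F : (Σ p : (Σ n : ℕ, SmirnovWord (n + 1)), (Fin p.1 → Step)) → SmirnovTree := fun q =>
    ⟨psi q.1.1 q.1.2.1 q.2, (psi_spec _ _ q.1.2.2 _).1⟩
  have hF : Function.Bijective F := by
    constructor
    · rintro ⟨⟨n, w⟩, S⟩ ⟨⟨m, v⟩, R⟩ h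
      have h' := bijOn_psi.injOn (Set.mem_univ ⟨n, w, S⟩) (Set.mem_univ ⟨m, v, R⟩)
        (congrArg Subtype.val h)
      obtain rfl : n = m := congrArg Sigma.fst h'
      simp only [Sigma.mk.injEq, heq_eq_eq, Prod.mk.injEq, true_and] at h'
      obtain ⟨rfl, rfl⟩ := h'
      rfl
    · intro T
      obtain ⟨⟨n, w, S⟩, -, h⟩ := bijOn_psi.surjOn T.2
      exact ⟨⟨⟨n, w⟩, S⟩, Subtype.ext h⟩
  have hG : HasSum (fun T : SmirnovTree => weight T.1) G := summable_weight.hasSum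
  rw [← (Equiv.ofBijective F hF).hasSum_iff] at hG
  refine hG.sigma fun p => ?_
  convert hasSum_pairWeight p.1 p.2 using 2 with S
  exact weight_psi _ _ p.2.2 _

end Smirnov

theorem mainTheorem2 :
    -- the family of weights of Smirnov trees is summable, so `G` is their sum,
    -- and `G` satisfies the functional equation
    (Summable (fun T : Smirnov.SmirnovTree => Smirnov.weight T.1) ∧
      HasSum
        (fun p : Σ n : ℕ, Smirnov.SmirnovWord (n + 1) =>
          Smirnov.s ^ Smirnov.asc p.2.1 * Smirnov.t ^ Smirnov.des p.2.1 * Smirnov.xWord p.2.1)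
        Smirnov.G) ∧
    -- `Ψ` is well defined: the letter passed to `Φ` always differs from the principal label
    -- of the tree passed to `Φ`, since that label is the preceding letter of the word
    (∀ (n : ℕ) (w : Smirnov.SmirnovWord (n + 1)) (S : Fin n → Smirnov.Step),
      Smirnov.principalLabel (Smirnov.psi n w.1 S) = w.1 (Fin.last n)) ∧
    -- `Ψ` preserves weights
    (∀ (n : ℕ) (w : Smirnov.SmirnovWord (n + 1)) (S : Fin n → Smirnov.Step),
      Smirnov.weight (Smirnov.psi n w.1 S) = Smirnov.pairWeight w.1 S) ∧
    -- `Ψ` is a bijection onto the set of Smirnov trees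
    Set.BijOn
      (fun p : Σ n : ℕ, Smirnov.SmirnovWord (n + 1) × (Fin n → Smirnov.Step) =>
        Smirnov.psi p.1 p.2.1.1 p.2.2)
      Set.univ {T | Smirnov.IsSmirnov T} :=
  ⟨⟨Smirnov.summable_weight, Smirnov.hasSum_smirnovWord⟩,
    fun n w S => (Smirnov.psi_spec n w.1 w.2 S).2,
    fun n w S => Smirnov.weight_psi n w.1 w.2 S, Smirnov.bijOn_psi⟩
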